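/- Fix $q\in\mathbb{C}$ with $0<|q|<1$ and put $T_xf(x)=f(qx)$, $(x)_\infty=\prod_{k\ge0}(1-xq^k)$, $[\lambda]=\frac{1-q^\lambda}{1-q}$. Consider systems $T_xy=A(x)y$ with labelled parameters $e_1,\dots,e_9,\kappa\in\mathbb{C}$, where $$A(x)=I+A^{(1)}x+A^{(2)}x^2+\kappa I x^3\ (3\times3),\qquad \det A(x)=\kappa^3\prod_{i=1}^9(x+e_i),\qquad e_i\ne e_j\ (i\neq j).$$ For $1\le i\le 8$ let $s_i$ be the transposition $e_i\leftrightarrow e_{i+1}$ of the parameters. Two systems are equivalent, $A\simeq A'$, if they have the same parameters and $G^{-1}A(x)G=A'(x)$ for all $x$ with a constant $G\in GL(3,\mathbb{C})$. *The $q$-middle convolution.* For a tuple $(B_1,\dots,B_N)$ of endomorphisms of $V$ let $G_i$ be the endomorphism of $V^N$ whose $i$-th block row is $(q^\lambda B_1,\dots,q^\lambda B_i+[\lambda]I,\dots,q^\lambda B_N)$ and whose other block rows are $0$. The subspaces $\mathcal K=\bigoplus_i\mathrm{Ker}\,B_i$ and $\mathcal L=\mathrm{Ker}(G_1+\dots+G_N)$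 are invariant, and $mc_\lambda(B_1,\dots,B_N)$ is the tuple $(\bar G_1,\dots,\bar G_N)$ induced on $V^N/(\mathcal K+\mathcal L)$. *The transformation $s_0=g^{-1}\circ mc_\lambda\circ g$.* Put $g(x)=(-x/e_1)_\infty(-x/e_2)_\infty(-x/e_3)_\infty$ and $q^\lambda=(\kappa e_1e_2e_3)^{-1}$. The gauge transformation by $g$ turns $A$ into $A'(x)=\frac{g(qx)}{g(x)}A(x)=\frac{A(x)}{(1+x/e_1)(1+x/e_2)(1+x/e_3)}$; let $A_1,A_2,A_3$ be the constant matrices with $\sum_{i=1}^3\frac{A_i}{x+e_i}=\frac{I-A'(x)}{(1-q)x}$. Let $(\bar G_1,\bar G_2,\bar G_3)=mc_\lambda(A_1,A_2,A_3)$, written as $3\times 3$ matrices in some basis of the quotient space. Then $s_0.A=\tilde A$ with $$\tilde A(x)=(1+x/e_1)(1+x/e_2)(1+x/e_3)\Big[I-(1-q)x\sum_{i=1}^3\frac{\bar G_i}{x+e_i}\Big],$$ with parameters $\tilde e_i=e_i$ $(i\le3)$, $\tilde e_i=\kappa e_1e_2e_3e_i$ $(i\ge4)$, $\tilde\kappa=\kappa^{-1}(e_1e_2e_3)^{-2}$.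 *Proposition.* Let $A$ be such a system with $\kappa e_ie_je_k\ne1$ for all pairwise distinct $i,j,k$, and assume that $(A_1,A_2,A_3)$ satisfies, for all $j\in\{1,2,3\}$ and $\tau\in\mathbb{C}$, $$(\ast)\ \bigcap_{i\ne j}\mathrm{Ker}\,A_i\cap\mathrm{Ker}(A_j+\tau)=\{0\},\qquad(\ast\ast)\ \sum_{i\neq j}\mathrm{Im}\,A_i+\mathrm{Im}(A_j+\tau)=\mathbb{C}^3 .$$ Then the quotient space is three-dimensional, $s_0.A$ is again a system of the above form (with the parameters $\tilde e_i$, $\tilde\kappa$), its class under $\simeq$ depends only on the class of $A$, and $$s_0.s_i.A\simeq s_i.s_0.A\quad(1\le i\le 8,\ i\neq3),\qquad s_0.s_0.A\simeq A .$$ Moreover $s_0$ is birational up to conjugation: $s_0$ is its own inverse up to $\simeq$, and near $A$, as well as near $s_0.A$, it is given by rational functions of the entries of $A^{(1)},A^{(2)}$ and of $e_1,\dots,e_9,\kappa$: there are rational functions, regular at the given system, which compute a representative of $s_0.A'$ for every system $A'$ of the above form, with $\kappa' e_i'e_j'e_k'\neq1$ for pairwise distinct $i,j,k$, at which they are regular.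 -/

import Mathlib

noncomputable section

namespace QE8

open Polynomial

/-! ### The `q`-middle convolution of a tuple of endomorphisms -/

section MiddleConvolution

variable {ι V : Type*} [Fintype ι] [DecidableEq ι] [AddCommGroup V] [Module ℂ V]

/-- The `q`-number `[λ] = (1 - q ^ λ) / (1 - q)`. -/
def qNumber (q lam : ℂ) : ℂ := (1 - q ^ lam) / (1 - q)

/-- The `q`-convolution `c_λ : (B_i) ↦ (G_i)` on `V ^ N`: the `i`-th block row of `G_i` is
`(q^λ B_1, …, q^λ B_i + [λ] I, …, q^λ B_N)` and all the other block rows vanish. -/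
def qConv (q lam : ℂ) (B : ι → Module.End ℂ V) (i : ι) : Module.End ℂ (ι → V) :=
  LinearMap.single ℂ (fun _ : ι => V) i ∘ₗ
    ((∑ j, q ^ lam • (B j ∘ₗ LinearMap.proj j)) + qNumber q lam • LinearMap.proj i)

/-- `𝒦 = Ker B_1 ⊕ ⋯ ⊕ Ker B_N`. -/
def mcK (B : ι → Module.End ℂ V) : Submodule ℂ (ι → V) :=
  Submodule.pi Set.univ fun i => LinearMap.ker (B i)

/-- `ℒ = Ker (G_1 + ⋯ + G_N)`. -/
def mcL (q lam : ℂ) (B : ι → Module.End ℂ V) : Submodule ℂ (ι → V) :=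
  LinearMap.ker (∑ i, qConv q lam B i)

theorem qConv_apply (q lam : ℂ) (B : ι → Module.End ℂ V) (i : ι) (v : ι → V) :
    qConv q lam B i v =
      Pi.single i ((∑ j, q ^ lam • B j (v j)) + qNumber q lam • v i) := by
  simp [qConv]

theorem mcK_le_comap (q lam : ℂ) (B : ι → Module.End ℂ V) (i : ι) :
    mcK B ≤ (mcK B).comap (qConv q lam B i) := by
  intro v hv
  have hv' : ∀ j, B j (v j) = 0 := fun j => by
    simpa using (Submodule.mem_pi.1 hv) j (Set.mem_univ j)
  rw [Submodule.mem_comap, qConv_apply]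
  refine Submodule.mem_pi.2 fun j _ => ?_
  rw [LinearMap.mem_ker]
  by_cases h : j = i
  · subst h
    simp [hv']
  · simp [Pi.single_eq_of_ne h]

theorem mcL_le_comap (q lam : ℂ) (B : ι → Module.End ℂ V) (i : ι) :
    mcL q lam B ≤ (mcL q lam B).comap (qConv q lam B i) := by
  intro v hv
  have h0 : qConv q lam B i v = 0 := by
    have h := congrFun (LinearMap.mem_ker.1 hv) i
    simp only [LinearMap.sum_apply, Finset.sum_apply, qConv_apply, Pi.single_apply,
      Finset.sum_ite_eq, Finset.mem_univ, if_true, Pi.zero_apply] at h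
    rw [qConv_apply, h, Pi.single_zero]
  rw [Submodule.mem_comap, h0]
  exact Submodule.zero_mem _

theorem mc_le_comap (q lam : ℂ) (B : ι → Module.End ℂ V) (i : ι) :
    mcK B ⊔ mcL q lam B ≤ (mcK B ⊔ mcL q lam B).comap (qConv q lam B i) :=
  sup_le ((mcK_le_comap q lam B i).trans (Submodule.comap_mono le_sup_left))
    ((mcL_le_comap q lam B i).trans (Submodule.comap_mono le_sup_right))

/-- The space `V ^ N / (𝒦 + ℒ)` on which the `q`-middle convolution acts. -/
abbrev MCSpace (q lam : ℂ) (B : ι → Module.End ℂ V) : Type _ :=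
  (ι → V) ⧸ (mcK B ⊔ mcL q lam B)

/-- The `q`-middle convolution `mc_λ : (B_i) ↦ (Ḡ_i)`, the tuple induced by `(G_i)` on
`V ^ N / (𝒦 + ℒ)`. -/
def qMC (q lam : ℂ) (B : ι → Module.End ℂ V) (i : ι) : Module.End ℂ (MCSpace q lam B) :=
  Submodule.mapQ _ _ (qConv q lam B i) (mc_le_comap q lam B i)

/-- Condition `(∗)`. -/
def Star (B : ι → Module.End ℂ V) : Prop :=
  ∀ (j : ι) (τ : ℂ),
    (⨅ i ∈ {i : ι | i ≠ j}, LinearMap.ker (B i)) ⊓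
      LinearMap.ker (B j + τ • (1 : Module.End ℂ V)) = ⊥

/-- Condition `(∗∗)`. -/
def StarStar (B : ι → Module.End ℂ V) : Prop :=
  ∀ (j : ι) (τ : ℂ),
    (⨆ i ∈ {i : ι | i ≠ j}, LinearMap.range (B i)) ⊔
      LinearMap.range (B j + τ • (1 : Module.End ℂ V)) = ⊤

end MiddleConvolution

/-! ### The rank three systems -/

/-- A system `T_x y = A(x) y` of rank three with polynomial coefficients, together with its
labelled parameters. The parameter `e_i` of the text is `e (i - 1)`. -/
structure QSystem where
  e : Fin 9 → ℂ
  κ : ℂ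
  A : Matrix (Fin 3) (Fin 3) ℂ[X]

namespace QSystem

/-- The value `A(x)`. -/
def at' (d : QSystem) (x : ℂ) : Matrix (Fin 3) (Fin 3) ℂ := d.A.map (Polynomial.eval x)

/-- `A = I + A⁽¹⁾ x + A⁽²⁾ x² + κ I x³` and `det A = κ³ ∏ (x + e_i)` with distinct `e_i`.
(Taking `x = 0` shows that `κ` and all the `e_i` are nonzero.) -/
structure IsE8 (d : QSystem) : Prop where
  form : ∃ A₁ A₂ : Matrix (Fin 3) (Fin 3) ℂ, ∀ x : ℂ,
    d.at' x = 1 + x • A₁ + x ^ 2 • A₂ + (d.κ * x ^ 3) • (1 : Matrix (Fin 3) (Fin 3) ℂ)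
  det_eq : ∀ x : ℂ, (d.at' x).det = d.κ ^ 3 * ∏ i, (x + d.e i)
  distinct : Function.Injective d.e

/-- `κ e_i e_j e_k ≠ 1` for pairwise distinct `i, j, k`. -/
def NonResonant (d : QSystem) : Prop :=
  ∀ i j k : Fin 9, i ≠ j → j ≠ k → k ≠ i → d.κ * d.e i * d.e j * d.e k ≠ 1

/-- Conjugation by a constant matrix in `GL(3)`, with the same parameters. -/
def Conj (a b : QSystem) : Prop :=
  a.e = b.e ∧ a.κ = b.κ ∧
    ∃ G : GL (Fin 3) ℂ, ∀ x : ℂ,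
      (↑G⁻¹ : Matrix (Fin 3) (Fin 3) ℂ) * a.at' x * (G : Matrix (Fin 3) (Fin 3) ℂ) = b.at' x

/-- The transposition `e_{i+1} ↔ e_{i+2}` of the parameters, for `i = 0, …, 7`; this is
`s_{i+1}`. -/
def swap (i : Fin 8) (d : QSystem) : QSystem :=
  { d with e := d.e ∘ Equiv.swap i.castSucc i.succ }

/-- The parameters `e_1, e_2, e_3`. -/
def e₃ (d : QSystem) (i : Fin 3) : ℂ := d.e (Fin.castLE (by norm_num) i)

/-- The product `e_1 e_2 e_3`. -/
def prod₃ (d : QSystem) : ℂ := ∏ i, d.e₃ i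

end QSystem

/-- `(x)_∞ = ∏_{k ≥ 0} (1 - x q^k)`. -/
def qPoch (q x : ℂ) : ℂ := ∏' k : ℕ, (1 - x * q ^ k)

/-- `g = (-x/e_1)_∞ (-x/e_2)_∞ (-x/e_3)_∞`. -/
def gaugeFun (q : ℂ) (d : QSystem) (x : ℂ) : ℂ := ∏ i, qPoch q (-x / d.e₃ i)

/-- The gauge transformation `y ↦ g y` takes `T_x y = A y` to `T_x y = (g(qx) / g(x)) A y`. -/
def gauge (q : ℂ) (g : ℂ → ℂ) (A : ℂ → Matrix (Fin 3) (Fin 3) ℂ) (x : ℂ) :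
    Matrix (Fin 3) (Fin 3) ℂ :=
  (g (q * x) / g x) • A x

/-- The constant matrices `A_1, A_2, A_3` with `∑ A_i / (x + e_i) = (I - A') / ((1 - q) x)`,
where `A'` is the gauge transform of `A` by `g`. -/
def IsResidueTuple (q : ℂ) (d : QSystem) (B : Fin 3 → Matrix (Fin 3) (Fin 3) ℂ) : Prop :=
  ∀ x : ℂ, x ≠ 0 → gaugeFun q d x ≠ 0 →
    ∑ i, (x + d.e₃ i)⁻¹ • B i = ((1 - q) * x)⁻¹ • (1 - gauge q (gaugeFun q d) d.at' x)

/-- The matrix `I - (1 - q) x ∑ C_i / (x + e_i)`: the system `D_x y = ∑ C_i / (x + e_i) y`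
rewritten with `T_x`. -/
def fuchsMatrix (q : ℂ) (d : QSystem) (C : Fin 3 → Matrix (Fin 3) (Fin 3) ℂ) (x : ℂ) :
    Matrix (Fin 3) (Fin 3) ℂ :=
  1 - ((1 - q) * x) • ∑ i, (x + d.e₃ i)⁻¹ • C i

/-- `b` is the transform `s_0 . d = (g⁻¹ ∘ mc_λ ∘ g) . d`, where `q ^ λ = (κ e_1 e_2 e_3)⁻¹`.
The middle convolution lives on a quotient space, and `ψ` is the basis of that space
in which it is written as a tuple of `3 × 3` matrices; the parameters are transformed by
`e_i ↦ e_i` for `i ≤ 3`, `e_i ↦ κ e_1 e_2 e_3 e_i` for `i > 3`, and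
`κ ↦ κ⁻¹ (e_1 e_2 e_3)⁻²`. -/
def IsS0 (q : ℂ) (d b : QSystem) : Prop :=
  (∀ i : Fin 9, b.e i = if (i : ℕ) < 3 then d.e i else d.κ * d.prod₃ * d.e i) ∧
  b.κ = (d.κ * d.prod₃ ^ 2)⁻¹ ∧
  ∃ (B : Fin 3 → Matrix (Fin 3) (Fin 3) ℂ) (lam : ℂ)
    (ψ : MCSpace q lam (fun i => Matrix.toLin' (B i)) ≃ₗ[ℂ] (Fin 3 → ℂ)),
    IsResidueTuple q d B ∧
    q ^ lam = (d.κ * d.prod₃)⁻¹ ∧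
    ∀ x : ℂ, gaugeFun q d x ≠ 0 →
      b.at' x = gauge q (fun z => (gaugeFun q d z)⁻¹)
        (fuchsMatrix q d fun i =>
          LinearMap.toMatrix' (ψ.conj (qMC q lam (fun i => Matrix.toLin' (B i)) i))) x

/-! ### Rationality of `s_0` -/

/-- The coordinates of a system: the entries of `A⁽¹⁾` and `A⁽²⁾`, the `e_i`, and `κ`. -/
abbrev Coord : Type := (Fin 2 × Fin 3 × Fin 3) ⊕ Fin 9 ⊕ Unit

def QSystem.coord (d : QSystem) : Coord → ℂ
  | .inl (k, i, j) => (d.A i j).coeff ((k : ℕ) + 1)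
  | .inr (.inl i) => d.e i
  | .inr (.inr _) => d.κ

/-- `s_0` is given near `d` by rational functions of the coordinates: there are rational
functions `P_v / Δ`, regular at `d`, that compute a representative of `s_0 . d'` for all
`d'` at which they are regular. -/
def S0RationalAt (q : ℂ) (d : QSystem) : Prop :=
  ∃ (P : Coord → MvPolynomial Coord ℂ) (Δ : MvPolynomial Coord ℂ),
    MvPolynomial.eval d.coord Δ ≠ 0 ∧
    ∀ d' : QSystem, d'.IsE8 → d'.NonResonant → MvPolynomial.eval d'.coord Δ ≠ 0 →
      ∃ b : QSystem, b.IsE8 ∧ IsS0 q d' b ∧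
        ∀ v, b.coord v = MvPolynomial.eval d'.coord (P v) / MvPolynomial.eval d'.coord Δ

end QE8

end

noncomputable section

namespace QE8

open Polynomial

/-! ### The gauge function -/

/-! Since g(qx)/g(x) = ∏ (1 + x/e_i)⁻¹, the gauge transformation only clears or introduces
denominators, and a system amounts to its residue tuple B, where B_i is a nonzero multiple of
A(-e_i). The function `fuchsVal` is this dictionary; below c = q^λ and s = [λ].

Two properties of B drive everything (`MCData`). The leading coefficient κI forces ∑ B_i to be
scalar, namely c ∑ B_i = -s, with s ≠ 0 by nonresonance. The zeros of det A are simple, so every Ker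
B_i is a line. Hence ℒ is the diagonal of V³, 𝒦 + ℒ consists of the v with all v_i - u in Ker B_i
for a common u, its dimension is 3 + 3, and the quotient has dimension 3.

The shape of s_0.A follows from ∑ C_i = s and from nine known zeros of the determinant: the C_i are
singular, and a kernel vector of A(cx) yields one of the new matrix at x
(`IsMC.det_fuchsVal_eq_zero`). The quotient depends on B only through its kernel, so conjugating or
permuting B conjugates or permutes the result (`IsMC.unique`, `IsMC.transfer`); this gives
independence of the representative and commutation with the s_i, i ≠ 3.

For the involution, the maps v ↦ B_i(row_i v) descend to the quotient, and their sum identifies the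
second middle convolution with V (`IsMC.symm`): (∗) shows that it kills the right subspace, (∗∗)
that it is onto, and dimensions agree. For rationality, a linear section is fixed, the kernel lines
are spanned by adjugate columns, and the projection to the quotient is read off from the inverse of
a 9 × 9 frame (`QSystem.Admissible.isS0_s0Rep`). -/

theorem multipliable_qPoch {q : ℂ} (hq : ‖q‖ < 1) (y : ℂ) :
    Multipliable fun k : ℕ => 1 - y * q ^ k := by
  have h : Summable fun k : ℕ => ‖-(y * q ^ k)‖ := by
    simpa using (summable_geometric_of_lt_one (norm_nonneg q) hq).mul_left ‖y‖
  simpa [sub_eq_add_neg] using multipliable_one_add_of_summable h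

theorem qPoch_eq_mul {q : ℂ} (hq : ‖q‖ < 1) (y : ℂ) :
    qPoch q y = (1 - y) * qPoch q (q * y) := by
  have h := tprod_eq_zero_mul' (f := fun k : ℕ => 1 - y * q ^ k)
    (by simpa [pow_succ, mul_comm, mul_left_comm, mul_assoc] using multipliable_qPoch hq (q * y))
  unfold qPoch
  rw [h]
  simp only [pow_zero, mul_one]
  congr 2
  funext k
  ring

theorem qPoch_ne_zero {q : ℂ} (hq : ‖q‖ < 1) {y : ℂ} (hy : ‖y‖ < 1) : qPoch q y ≠ 0 := by
  have h : Summable fun k : ℕ => ‖-(y * q ^ k)‖ := by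
    simpa using (summable_geometric_of_lt_one (norm_nonneg q) hq).mul_left ‖y‖
  have := tprod_one_add_ne_zero_of_summable (f := fun k : ℕ => -(y * q ^ k)) (fun k h0 => ?_) h
  · simpa [qPoch, sub_eq_add_neg] using this
  · have h1 : y * q ^ k = 1 := by linear_combination -h0
    have h2 : ‖y * q ^ k‖ < 1 := by
      rw [norm_mul, norm_pow]
      calc ‖y‖ * ‖q‖ ^ k ≤ ‖y‖ * 1 :=
            mul_le_mul_of_nonneg_left (pow_le_one₀ (norm_nonneg _) hq.le) (norm_nonneg _)
        _ < 1 := by simpa using hy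
    rw [h1] at h2
    simp at h2

theorem gaugeFun_eq_mul {q : ℂ} (hq : ‖q‖ < 1) (d : QSystem) (x : ℂ) :
    gaugeFun q d x = (∏ i, (1 + x / d.e₃ i)) * gaugeFun q d (q * x) := by
  unfold gaugeFun
  rw [← Finset.prod_mul_distrib]
  refine Finset.prod_congr rfl fun i _ => ?_
  rw [qPoch_eq_mul hq]
  congr 2 <;> ring

/-- The defining relations are only required where g does not vanish. A disc around 0 free of zeros
suffices to turn them into identities of polynomials. -/
theorem exists_gaugeFun_ne_zero {q : ℂ} (hq : ‖q‖ < 1) {d : QSystem} (he : ∀ i, d.e₃ i ≠ 0) :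
    ∃ r > 0, ∀ x : ℂ, ‖x‖ < r → gaugeFun q d x ≠ 0 := by
  refine ⟨min ‖d.e₃ 0‖ (min ‖d.e₃ 1‖ ‖d.e₃ 2‖), by simp [he], fun x hx => ?_⟩
  refine Finset.prod_ne_zero_iff.2 fun i _ => qPoch_ne_zero hq ?_
  have hi : 0 < ‖d.e₃ i‖ := norm_pos_iff.2 (he i)
  rw [norm_div, norm_neg, div_lt_one hi]
  simp only [lt_min_iff] at hx
  fin_cases i
  exacts [hx.1, hx.2.1, hx.2.2]

theorem polynomial_eq_of_eval_eq_near_zero {p p' : ℂ[X]} {r : ℝ} (hr : 0 < r)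
    (h : ∀ x : ℂ, x ≠ 0 → ‖x‖ < r → p.eval x = p'.eval x) : p = p' := by
  refine Polynomial.eq_of_infinite_eval_eq p p' (Set.Infinite.mono
    (s := Set.image (fun t : ℝ => (t : ℂ)) (Set.Ioo 0 r)) ?_ ((Set.Ioo_infinite hr).image (Complex.ofReal_injective.injOn)))
  rintro _ ⟨t, ⟨h0, h1⟩, rfl⟩
  refine h t (by exact_mod_cast h0.ne') ?_
  simpa [abs_of_pos h0] using h1

/-! ### Fuchsian systems with three finite singularities, cleared of denominators -/

/-- The coefficient of `x` in `∏ (1 + x / e_i) (1 - (1 - q) x ∑ C_i / (x + e_i))`. -/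
def fuchsCoeff₁ (q : ℂ) (e : Fin 3 → ℂ) (C : Fin 3 → Matrix (Fin 3) (Fin 3) ℂ) :
    Matrix (Fin 3) (Fin 3) ℂ :=
  (∑ i, (e i)⁻¹) • (1 : Matrix (Fin 3) (Fin 3) ℂ) - (1 - q) • ∑ i, (e i)⁻¹ • C i

/-- The coefficient of `x ^ 2` in `∏ (1 + x / e_i) (1 - (1 - q) x ∑ C_i / (x + e_i))`. -/
def fuchsCoeff₂ (q : ℂ) (e : Fin 3 → ℂ) (C : Fin 3 → Matrix (Fin 3) (Fin 3) ℂ) :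
    Matrix (Fin 3) (Fin 3) ℂ :=
  (∏ i, e i)⁻¹ • ((∑ i, e i) • (1 : Matrix (Fin 3) (Fin 3) ℂ) -
    (1 - q) • ∑ i, ((∑ j, e j) - e i) • C i)

/-- The coefficient of `x ^ 3` in `∏ (1 + x / e_i) (1 - (1 - q) x ∑ C_i / (x + e_i))`. -/
def fuchsCoeff₃ (q : ℂ) (e : Fin 3 → ℂ) (C : Fin 3 → Matrix (Fin 3) (Fin 3) ℂ) :
    Matrix (Fin 3) (Fin 3) ℂ :=
  (∏ i, e i)⁻¹ • ((1 : Matrix (Fin 3) (Fin 3) ℂ) - (1 - q) • ∑ i, C i)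

/-- `∏ (1 + x / e_i) (1 - (1 - q) x ∑ C_i / (x + e_i))` as a polynomial function. -/
def fuchsVal (q : ℂ) (e : Fin 3 → ℂ) (C : Fin 3 → Matrix (Fin 3) (Fin 3) ℂ) (x : ℂ) :
    Matrix (Fin 3) (Fin 3) ℂ :=
  1 + x • fuchsCoeff₁ q e C + x ^ 2 • fuchsCoeff₂ q e C + x ^ 3 • fuchsCoeff₃ q e C

/-- `∏ (1 + x / e_i) (1 - (1 - q) x ∑ C_i / (x + e_i))` as a matrix of polynomials. -/
def fuchsPoly (q : ℂ) (e : Fin 3 → ℂ) (M : Fin 3 → Matrix (Fin 3) (Fin 3) ℂ) :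
    Matrix (Fin 3) (Fin 3) ℂ[X] :=
  Matrix.of fun a b => C ((1 : Matrix (Fin 3) (Fin 3) ℂ) a b) + C (fuchsCoeff₁ q e M a b) * X +
    C (fuchsCoeff₂ q e M a b) * X ^ 2 + C (fuchsCoeff₃ q e M a b) * X ^ 3

theorem fuchsPoly_map_eval (q : ℂ) (e : Fin 3 → ℂ) (M : Fin 3 → Matrix (Fin 3) (Fin 3) ℂ) (x : ℂ) :
    (fuchsPoly q e M).map (Polynomial.eval x) = fuchsVal q e M x := by
  ext a b
  simp [fuchsPoly, fuchsVal]
  ring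

theorem fuchsVal_eq {q : ℂ} {e : Fin 3 → ℂ} (he : ∀ i, e i ≠ 0)
    (C : Fin 3 → Matrix (Fin 3) (Fin 3) ℂ) {x : ℂ} (hx : ∀ i, x + e i ≠ 0) :
    fuchsVal q e C x =
      (∏ i, (1 + x / e i)) • (1 - ((1 - q) * x) • ∑ i, (x + e i)⁻¹ • C i) := by
  have h0 := he 0; have h1 := he 1; have h2 := he 2
  have k0 := hx 0; have k1 := hx 1; have k2 := hx 2
  ext a b
  simp only [fuchsVal, fuchsCoeff₁, fuchsCoeff₂, fuchsCoeff₃, Fin.sum_univ_three,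
    Fin.prod_univ_three, Matrix.add_apply, Matrix.sub_apply, Matrix.smul_apply, smul_eq_mul]
  generalize (1 : Matrix (Fin 3) (Fin 3) ℂ) a b = δ
  field_simp
  ring

/-- At x = -e_i the factor 1 + x/e_i kills everything except the pole of the i-th term, so the value
is a multiple of the residue. -/
theorem fuchsVal_neg {q : ℂ} {e : Fin 3 → ℂ} (he : ∀ i, e i ≠ 0)
    (C : Fin 3 → Matrix (Fin 3) (Fin 3) ℂ) (i : Fin 3) :
    fuchsVal q e C (-e i) =
      ((1 - q) * ∏ j ∈ Finset.univ.erase i, (1 - e i / e j)) • C i := by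
  have h0 := he 0; have h1 := he 1; have h2 := he 2
  have e0 : (Finset.univ : Finset (Fin 3)).erase 0 = {1, 2} := by decide
  have e1 : (Finset.univ : Finset (Fin 3)).erase 1 = {0, 2} := by decide
  have e2 : (Finset.univ : Finset (Fin 3)).erase 2 = {0, 1} := by decide
  ext a b
  simp only [fuchsVal, fuchsCoeff₁, fuchsCoeff₂, fuchsCoeff₃, Fin.sum_univ_three,
    Fin.prod_univ_three, Matrix.add_apply, Matrix.sub_apply, Matrix.smul_apply, smul_eq_mul]
  generalize (1 : Matrix (Fin 3) (Fin 3) ℂ) a b = δ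
  fin_cases i
  · simp only [Fin.zero_eta, e0]
    rw [Finset.prod_pair (by decide)]
    field_simp
    ring
  · simp only [Fin.mk_one, e1]
    rw [Finset.prod_pair (by decide)]
    field_simp
    ring
  · simp only [Fin.reduceFinMk, e2]
    rw [Finset.prod_pair (by decide)]
    field_simp
    ring

/-- The third finite difference of a cubic is 3! times its leading coefficient; the last term is the
value 1 at x = 0. -/
theorem fuchsCoeff₃_eq (q : ℂ) (e : Fin 3 → ℂ) (C : Fin 3 → Matrix (Fin 3) (Fin 3) ℂ) :
    (6 : ℂ) • fuchsCoeff₃ q e C = fuchsVal q e C 3 - (3 : ℂ) • fuchsVal q e C 2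
      + (3 : ℂ) • fuchsVal q e C 1 - 1 := by
  ext a b
  simp [fuchsVal]
  ring

/-- The factor `(1 - q) ∏_{j ≠ i} (1 - e_i / e_j)` between `A(-e_i)` and the residue at `-e_i`. -/
def resFactor (q : ℂ) (e : Fin 3 → ℂ) (i : Fin 3) : ℂ :=
  (1 - q) * ∏ j ∈ Finset.univ.erase i, (1 - e i / e j)

theorem resFactor_ne_zero {q : ℂ} (hq : 1 - q ≠ 0) {e : Fin 3 → ℂ} (he : ∀ i, e i ≠ 0)
    (hinj : Function.Injective e) (i : Fin 3) : resFactor q e i ≠ 0 := by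
  refine mul_ne_zero hq (Finset.prod_ne_zero_iff.2 fun j hj => ?_)
  rw [sub_ne_zero, ne_comm, Ne, div_eq_one_iff_eq (he j)]
  exact fun h => (Finset.ne_of_mem_erase hj) (hinj h).symm

theorem fuchsVal_injective {q : ℂ} (hq : 1 - q ≠ 0) {e : Fin 3 → ℂ} (he : ∀ i, e i ≠ 0)
    (hinj : Function.Injective e) {C C' : Fin 3 → Matrix (Fin 3) (Fin 3) ℂ}
    (h : ∀ x, fuchsVal q e C x = fuchsVal q e C' x) : C = C' := by
  funext i
  have hi := h (-e i)
  rw [fuchsVal_neg he, fuchsVal_neg he] at hi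
  exact smul_right_injective _ (resFactor_ne_zero hq he hinj i) hi

/-- Lagrange interpolation at `-e_0, -e_1, -e_2`. -/
theorem exists_fuchsVal {q : ℂ} (hq : 1 - q ≠ 0) {e : Fin 3 → ℂ} (he : ∀ i, e i ≠ 0)
    (hinj : Function.Injective e) (κ : ℂ) (A₁ A₂ : Matrix (Fin 3) (Fin 3) ℂ) (x : ℂ) :
    fuchsVal q e (fun i => (resFactor q e i)⁻¹ • (1 + (-e i) • A₁ + (-e i) ^ 2 • A₂ +
      (κ * (-e i) ^ 3) • (1 : Matrix (Fin 3) (Fin 3) ℂ))) x =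
    1 + x • A₁ + x ^ 2 • A₂ + (κ * x ^ 3) • (1 : Matrix (Fin 3) (Fin 3) ℂ) := by
  have h0 := he 0; have h1 := he 1; have h2 := he 2
  have e0 : (Finset.univ : Finset (Fin 3)).erase 0 = {1, 2} := by decide
  have e1 : (Finset.univ : Finset (Fin 3)).erase 1 = {0, 2} := by decide
  have e2 : (Finset.univ : Finset (Fin 3)).erase 2 = {0, 1} := by decide
  have r0 : resFactor q e 0 = (1 - q) * ((e 1 - e 0) * (e 2 - e 0)) / (e 1 * e 2) := by
    rw [resFactor, e0, Finset.prod_pair (by decide)]; field_simp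
  have r1 : resFactor q e 1 = (1 - q) * ((e 0 - e 1) * (e 2 - e 1)) / (e 0 * e 2) := by
    rw [resFactor, e1, Finset.prod_pair (by decide)]; field_simp
  have r2 : resFactor q e 2 = (1 - q) * ((e 0 - e 2) * (e 1 - e 2)) / (e 0 * e 1) := by
    rw [resFactor, e2, Finset.prod_pair (by decide)]; field_simp
  have d01 : e 0 - e 1 ≠ 0 := sub_ne_zero.2 fun h => absurd (hinj h) (by decide)
  have d02 : e 0 - e 2 ≠ 0 := sub_ne_zero.2 fun h => absurd (hinj h) (by decide)
  have d12 : e 1 - e 2 ≠ 0 := sub_ne_zero.2 fun h => absurd (hinj h) (by decide)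
  -- The signs are aligned so that all denominators are products of the three differences known to
  -- be nonzero.
  rw [← neg_sub (e 0) (e 1), ← neg_sub (e 0) (e 2)] at r0
  rw [← neg_sub (e 1) (e 2)] at r1
  ext a b
  simp only [fuchsVal, fuchsCoeff₁, fuchsCoeff₂, fuchsCoeff₃, Fin.sum_univ_three,
    Fin.prod_univ_three, Matrix.add_apply, Matrix.sub_apply, Matrix.smul_apply, smul_eq_mul,
    r0, r1, r2]
  generalize (1 : Matrix (Fin 3) (Fin 3) ℂ) a b = δ
  field_simp
  ring

/-! ### Residue tuples in terms of `fuchsVal` -/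

theorem one_sub_ne_zero_of_norm_lt_one {q : ℂ} (hq : ‖q‖ < 1) : 1 - q ≠ 0 := by
  intro h
  rw [← sub_eq_zero.1 h] at hq
  simp at hq

theorem add_e₃_ne_zero {q : ℂ} (hq : ‖q‖ < 1) {d : QSystem} (he : ∀ i, d.e₃ i ≠ 0) {x : ℂ}
    (hx : gaugeFun q d x ≠ 0) (i : Fin 3) : x + d.e₃ i ≠ 0 := by
  rw [gaugeFun_eq_mul hq] at hx
  have h := Finset.prod_ne_zero_iff.1 (left_ne_zero_of_mul hx) i (Finset.mem_univ i)
  intro h0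
  apply h
  field_simp [he i]
  linear_combination h0

theorem gauge_gaugeFun {q : ℂ} (hq : ‖q‖ < 1) {d : QSystem}
    (A : ℂ → Matrix (Fin 3) (Fin 3) ℂ) {x : ℂ} (hx : gaugeFun q d x ≠ 0) :
    gauge q (gaugeFun q d) A x = (∏ i, (1 + x / d.e₃ i))⁻¹ • A x := by
  rw [gauge]
  congr 1
  rw [gaugeFun_eq_mul hq] at hx
  rw [gaugeFun_eq_mul hq d x]
  have := right_ne_zero_of_mul hx
  have := left_ne_zero_of_mul hx
  field_simp

theorem gauge_inv_fuchsMatrix {q : ℂ} (hq : ‖q‖ < 1) {d : QSystem} (he : ∀ i, d.e₃ i ≠ 0)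
    (C : Fin 3 → Matrix (Fin 3) (Fin 3) ℂ) {x : ℂ} (hx : gaugeFun q d x ≠ 0) :
    gauge q (fun z => (gaugeFun q d z)⁻¹) (fuchsMatrix q d C) x = fuchsVal q d.e₃ C x := by
  rw [fuchsVal_eq he C (add_e₃_ne_zero hq he hx), gauge, fuchsMatrix]
  congr 1
  rw [gaugeFun_eq_mul hq] at hx
  rw [gaugeFun_eq_mul hq d x]
  have := right_ne_zero_of_mul hx
  have := left_ne_zero_of_mul hx
  field_simp

/-- Both sides are polynomial in x, so agreement on a punctured disc where g ≠ 0 propagates to all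
x, including the zeros of g. -/
theorem at'_eq_fuchsVal {q : ℂ} (hq : ‖q‖ < 1) {d b : QSystem} (he : ∀ i, d.e₃ i ≠ 0)
    {C : Fin 3 → Matrix (Fin 3) (Fin 3) ℂ}
    (h : ∀ x, x ≠ 0 → gaugeFun q d x ≠ 0 → b.at' x = fuchsVal q d.e₃ C x) (x : ℂ) :
    b.at' x = fuchsVal q d.e₃ C x := by
  obtain ⟨r, hr, hg⟩ := exists_gaugeFun_ne_zero hq he
  have : b.A = fuchsPoly q d.e₃ C := by
    ext1 i j
    refine polynomial_eq_of_eval_eq_near_zero hr fun y h0 h1 => ?_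
    have h2 := h y h0 (hg y h1)
    rw [← fuchsPoly_map_eval] at h2
    exact congrFun (congrFun h2 i) j
  rw [QSystem.at', this, fuchsPoly_map_eval]

theorem isResidueTuple_iff {q : ℂ} (hq : ‖q‖ < 1) {d : QSystem} (he : ∀ i, d.e₃ i ≠ 0)
    {B : Fin 3 → Matrix (Fin 3) (Fin 3) ℂ} :
    IsResidueTuple q d B ↔ ∀ x, d.at' x = fuchsVal q d.e₃ B x := by
  have h1q := one_sub_ne_zero_of_norm_lt_one hq
  have hP : ∀ x, gaugeFun q d x ≠ 0 → (∏ i, (1 + x / d.e₃ i)) ≠ 0 := fun x hx => by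
    rw [gaugeFun_eq_mul hq] at hx
    exact left_ne_zero_of_mul hx
  constructor
  · intro h
    refine at'_eq_fuchsVal hq he fun x h0 hx => ?_
    rw [fuchsVal_eq he B (add_e₃_ne_zero hq he hx), h x h0 hx, gauge_gaugeFun hq _ hx,
      smul_smul, mul_inv_cancel₀ (mul_ne_zero h1q h0), one_smul, sub_sub_cancel, smul_smul,
      mul_inv_cancel₀ (hP x hx), one_smul]
  · intro h x h0 hx
    rw [gauge_gaugeFun hq _ hx, h, fuchsVal_eq he B (add_e₃_ne_zero hq he hx), smul_smul,
      inv_mul_cancel₀ (hP x hx), one_smul, sub_sub_cancel, smul_smul,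
      inv_mul_cancel₀ (mul_ne_zero h1q h0), one_smul]

theorem s0_matrix_iff {q : ℂ} (hq : ‖q‖ < 1) {d b : QSystem} (he : ∀ i, d.e₃ i ≠ 0)
    {C : Fin 3 → Matrix (Fin 3) (Fin 3) ℂ} :
    (∀ x : ℂ, gaugeFun q d x ≠ 0 →
      b.at' x = gauge q (fun z => (gaugeFun q d z)⁻¹) (fuchsMatrix q d C) x) ↔
    ∀ x, b.at' x = fuchsVal q d.e₃ C x := by
  constructor
  · intro h
    refine at'_eq_fuchsVal hq he fun x _ hx => ?_
    rw [h x hx, gauge_inv_fuchsMatrix hq he C hx]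
  · intro h x hx
    rw [h x, gauge_inv_fuchsMatrix hq he C hx]

/-! ### `3 × 3` matrices of rank two -/

/-- The linear term involves adj A, so a singular A with adj A = 0 produces a multiple zero at t =
0. -/
theorem det_add_smul (A N : Matrix (Fin 3) (Fin 3) ℂ) (t : ℂ) :
    (A + t • N).det = A.det + t * (A.adjugate * N).trace + t ^ 2 * (A * N.adjugate).trace +
      t ^ 3 * N.det := by
  simp [Matrix.det_fin_three, Matrix.adjugate_fin_three, Matrix.trace_fin_three,
    Matrix.mul_apply, Fin.sum_univ_three, Matrix.vecMul, dotProduct]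
  ring

/-- The j-th column of adj B is the cross product of the two rows other than the j-th. A kernel
vector v is orthogonal to both rows, so v × (r × r') = 0 and v is parallel to that column. -/
theorem adjugate_mul_comm_of_mulVec_eq_zero {B : Matrix (Fin 3) (Fin 3) ℂ} {v : Fin 3 → ℂ}
    (h : B.mulVec v = 0) (a b j : Fin 3) :
    B.adjugate a j * v b = B.adjugate b j * v a := by
  have h0 := congrFun h 0
  have h1 := congrFun h 1
  have h2 := congrFun h 2
  simp only [Matrix.mulVec, dotProduct, Fin.sum_univ_three, Pi.zero_apply] at h0 h1 h2
  rw [Matrix.adjugate_fin_three]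
  fin_cases j <;> fin_cases a <;> fin_cases b <;> simp <;> grind

/-- If the `j`-th column of `adj B` is a nonzero vector of `ker B`, then it spans `ker B`. -/
theorem mulVec_eq_zero_iff_of_adjugate {B : Matrix (Fin 3) (Fin 3) ℂ} (hB : B.det = 0) {j : Fin 3}
    (hj : B.adjugate.col j ≠ 0) (v : Fin 3 → ℂ) :
    B.mulVec v = 0 ↔ ∃ t : ℂ, v = t • B.adjugate.col j := by
  constructor
  · intro h
    obtain ⟨a, ha⟩ := Function.ne_iff.1 hj
    refine ⟨v a / B.adjugate a j, funext fun b => ?_⟩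
    have := adjugate_mul_comm_of_mulVec_eq_zero h a b j
    simp only [Matrix.col_apply, Pi.zero_apply, Pi.smul_apply, smul_eq_mul] at ha ⊢
    field_simp
    linear_combination this
  · rintro ⟨t, rfl⟩
    have : B.mulVec (B.adjugate.col j) = 0 := by
      funext i
      have := congrFun (congrFun (Matrix.mul_adjugate B) i) j
      simpa [hB, Matrix.mul_apply, Matrix.mulVec, dotProduct] using this
    rw [Matrix.mulVec_smul, this, smul_zero]

/-- `ker B` is a line. -/
def KerLine (B : Matrix (Fin 3) (Fin 3) ℂ) : Prop :=
  ∃ k : Fin 3 → ℂ, k ≠ 0 ∧ ∀ v, B.mulVec v = 0 ↔ ∃ t : ℂ, v = t • k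

theorem exists_col_ne_zero {M : Matrix (Fin 3) (Fin 3) ℂ} (h : M ≠ 0) : ∃ j, M.col j ≠ 0 := by
  by_contra! h0
  exact h (Matrix.ext fun i j => congrFun (h0 j) i)

theorem kerLine_of_adjugate_ne_zero {B : Matrix (Fin 3) (Fin 3) ℂ} (hB : B.det = 0)
    (h : B.adjugate ≠ 0) : KerLine B := by
  obtain ⟨j, hj⟩ := exists_col_ne_zero h
  exact ⟨_, hj, mulVec_eq_zero_iff_of_adjugate hB hj⟩

/-! ### Consequences of the shape of the systems -/

namespace QSystem

variable {d : QSystem}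

theorem IsE8.at'_zero (hd : d.IsE8) : d.at' 0 = 1 := by
  obtain ⟨A₁, A₂, h⟩ := hd.form
  simp [h]

theorem IsE8.prod_eq_one (hd : d.IsE8) : d.κ ^ 3 * ∏ i, d.e i = 1 := by
  have := hd.det_eq 0
  simpa [hd.at'_zero] using this.symm

theorem IsE8.κ_ne_zero (hd : d.IsE8) : d.κ ≠ 0 := by
  intro h
  simpa [h] using hd.prod_eq_one

theorem IsE8.e_ne_zero (hd : d.IsE8) (i : Fin 9) : d.e i ≠ 0 := by
  have h : ∏ i, d.e i ≠ 0 := fun h => by simpa [h] using hd.prod_eq_one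
  exact Finset.prod_ne_zero_iff.1 h i (Finset.mem_univ i)

theorem IsE8.e₃_ne_zero (hd : d.IsE8) (i : Fin 3) : d.e₃ i ≠ 0 := hd.e_ne_zero _

theorem IsE8.e₃_injective (hd : d.IsE8) : Function.Injective d.e₃ := fun _ _ h =>
  Fin.castLE_injective _ (hd.distinct h)

theorem IsE8.prod₃_ne_zero (hd : d.IsE8) : d.prod₃ ≠ 0 :=
  Finset.prod_ne_zero_iff.2 fun i _ => hd.e₃_ne_zero i

theorem IsE8.exists_fuchsVal {q : ℂ} (hq : 1 - q ≠ 0) (hd : d.IsE8) (x : ℂ) :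
    d.at' x = fuchsVal q d.e₃ (fun i => (resFactor q d.e₃ i)⁻¹ • d.at' (-d.e₃ i)) x := by
  obtain ⟨A₁, A₂, h⟩ := hd.form
  simp only [h]
  exact (QE8.exists_fuchsVal hq hd.e₃_ne_zero hd.e₃_injective d.κ A₁ A₂ x).symm

theorem IsE8.fuchsCoeff₃ {q : ℂ} (hd : d.IsE8) {B : Fin 3 → Matrix (Fin 3) (Fin 3) ℂ}
    (hB : ∀ x, d.at' x = fuchsVal q d.e₃ B x) :
    fuchsCoeff₃ q d.e₃ B = d.κ • (1 : Matrix (Fin 3) (Fin 3) ℂ) := by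
  obtain ⟨A₁, A₂, h⟩ := hd.form
  have h6 := fuchsCoeff₃_eq q d.e₃ B
  simp only [← hB, h] at h6
  ext a b
  have := congrFun (congrFun h6 a) b
  simp only [Matrix.add_apply, Matrix.sub_apply, Matrix.smul_apply, smul_eq_mul] at this ⊢
  linear_combination this / 6

/-- The leading coefficient of the cleared system is an affine function of the sum of the residues
and equals κI. This scalar sum is what makes ℒ the diagonal. -/
theorem IsE8.sum_residues {q : ℂ} (hq : 1 - q ≠ 0) (hd : d.IsE8)
    {B : Fin 3 → Matrix (Fin 3) (Fin 3) ℂ} (hB : ∀ x, d.at' x = fuchsVal q d.e₃ B x) :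
    ∑ i, B i = ((1 - d.κ * d.prod₃) / (1 - q)) • (1 : Matrix (Fin 3) (Fin 3) ℂ) := by
  have h := hd.fuchsCoeff₃ hB
  have hE := hd.prod₃_ne_zero
  rw [QE8.fuchsCoeff₃] at h
  change (d.prod₃)⁻¹ • _ = _ at h
  ext a b
  have h' := congrFun (congrFun h a) b
  simp only [Matrix.sub_apply, Matrix.smul_apply, smul_eq_mul] at h' ⊢
  field_simp at h' ⊢
  linear_combination -h'

theorem IsE8.det_neg_e (hd : d.IsE8) (i : Fin 9) : (d.at' (-d.e i)).det = 0 := by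
  rw [hd.det_eq, Finset.prod_eq_zero (Finset.mem_univ i) (by simp), mul_zero]

/-- The zeros of `det A` are simple, so `A(-e_i)` has rank two. -/
theorem IsE8.adjugate_ne_zero (hd : d.IsE8) (i : Fin 9) : (d.at' (-d.e i)).adjugate ≠ 0 := by
  intro h0
  obtain ⟨A₁, A₂, h⟩ := hd.form
  set y := -d.e i with hy
  -- The difference quotient (A(y + t) - A(y)) / t, continuous also at t = 0.
  let N : ℂ → Matrix (Fin 3) (Fin 3) ℂ := fun t =>
    A₁ + (2 * y + t) • A₂ + (d.κ * (3 * y ^ 2 + 3 * y * t + t ^ 2)) • (1 : Matrix _ _ ℂ)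
  have hN : ∀ t, d.at' (y + t) = d.at' y + t • N t := fun t => by
    simp only [h, N]
    ext a b
    simp only [Matrix.add_apply, Matrix.smul_apply, smul_eq_mul]
    ring
  have hdet : ∀ t, t * (d.κ ^ 3 * ∏ j ∈ Finset.univ.erase i, (y + t + d.e j)) =
      t * (t * (d.at' y * (N t).adjugate).trace + t ^ 2 * (N t).det) := fun t => by
    have h1 := hd.det_eq (y + t)
    rw [hN, det_add_smul, h0, hd.det_neg_e i, ← Finset.mul_prod_erase _ _ (Finset.mem_univ i)] at h1
    simp only [zero_mul, Matrix.trace_zero, mul_zero, add_zero, zero_add] at h1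
    have h2 : y + t + d.e i = t := by rw [hy]; ring
    rw [h2] at h1
    linear_combination -h1
  have hcN : Continuous N := by fun_prop
  -- One factor t cancels for t ≠ 0, and continuity extends the identity to t = 0. There the right
  -- side vanishes, while the left side is nonzero because the e_j are distinct.
  have h1 : (fun t => d.κ ^ 3 * ∏ j ∈ Finset.univ.erase i, (y + t + d.e j)) =
      fun t => t * (d.at' y * (N t).adjugate).trace + t ^ 2 * (N t).det := by
    refine Continuous.ext_on (dense_compl_singleton (0 : ℂ)) (by fun_prop) ?_ fun t ht => ?_
    · refine Continuous.add (continuous_id.mul ?_) (.mul (by fun_prop) hcN.matrix_det)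
      exact (continuous_const.matrix_mul hcN.matrix_adjugate).matrix_trace
    · exact mul_left_cancel₀ ht (hdet t)
  have h2 := congrFun h1 0
  simp only [zero_mul, ne_eq, OfNat.ofNat_ne_zero, not_false_eq_true, zero_pow, add_zero] at h2
  refine mul_ne_zero (pow_ne_zero 3 hd.κ_ne_zero) (Finset.prod_ne_zero_iff.2 fun j hj => ?_) h2
  rw [hy, neg_add_eq_sub, sub_ne_zero]
  exact fun h => Finset.ne_of_mem_erase hj (hd.distinct h)

theorem IsE8.kerLine_residue {q : ℂ} (hq : 1 - q ≠ 0) (hd : d.IsE8)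
    {B : Fin 3 → Matrix (Fin 3) (Fin 3) ℂ} (hB : ∀ x, d.at' x = fuchsVal q d.e₃ B x)
    (i : Fin 3) : KerLine (B i) := by
  obtain ⟨k, hk, h⟩ := kerLine_of_adjugate_ne_zero (hd.det_neg_e _)
    (hd.adjugate_ne_zero (Fin.castLE (by norm_num) i))
  refine ⟨k, hk, fun v => ?_⟩
  rw [← h, show d.e (Fin.castLE _ i) = d.e₃ i from rfl, hB, fuchsVal_neg hd.e₃_ne_zero,
    Matrix.smul_mulVec, smul_eq_zero_iff_right]
  exact resFactor_ne_zero hq hd.e₃_ne_zero hd.e₃_injective i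

end QSystem

/-! ### Concrete models of the middle convolution -/

/-- The nonzero block row of the convolution matrix `G_i`. -/
def convRow (c s : ℂ) (B : Fin 3 → Matrix (Fin 3) (Fin 3) ℂ) (i : Fin 3) :
    (Fin 3 → Fin 3 → ℂ) →ₗ[ℂ] (Fin 3 → ℂ) :=
  c • ∑ j, (B j).mulVecLin ∘ₗ LinearMap.proj j + s • LinearMap.proj i

theorem convRow_apply (c s : ℂ) (B : Fin 3 → Matrix (Fin 3) (Fin 3) ℂ) (i : Fin 3)
    (v : Fin 3 → Fin 3 → ℂ) :
    convRow c s B i v = c • ∑ j, (B j).mulVec (v j) + s • v i := by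
  simp [convRow]

/-- The subspace `𝒦 + ℒ` in the case that `∑ B_i` is a scalar. -/
def mcKernel (B : Fin 3 → Matrix (Fin 3) (Fin 3) ℂ) : Submodule ℂ (Fin 3 → Fin 3 → ℂ) where
  carrier := {v | ∃ u : Fin 3 → ℂ, ∀ i, (B i).mulVec (v i - u) = 0}
  zero_mem' := ⟨0, by simp⟩
  add_mem' := by
    rintro v w ⟨u, hu⟩ ⟨u', hu'⟩
    refine ⟨u + u', fun i => ?_⟩
    rw [Pi.add_apply, add_sub_add_comm, Matrix.mulVec_add, hu, hu', add_zero]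
  smul_mem' := by
    rintro t v ⟨u, hu⟩
    refine ⟨t • u, fun i => ?_⟩
    rw [Pi.smul_apply, ← smul_sub, Matrix.mulVec_smul, hu, smul_zero]

theorem mem_mcKernel {B : Fin 3 → Matrix (Fin 3) (Fin 3) ℂ} {v : Fin 3 → Fin 3 → ℂ} :
    v ∈ mcKernel B ↔ ∃ u : Fin 3 → ℂ, ∀ i, (B i).mulVec (v i - u) = 0 := Iff.rfl

/-- The tuple `C` is the middle convolution of `B`, with respect to the basis of the quotient
space given by `π`. Here `c = q ^ λ` and `s = [λ]`. -/
def IsMC (c s : ℂ) (B C : Fin 3 → Matrix (Fin 3) (Fin 3) ℂ) : Prop :=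
  ∃ π : (Fin 3 → Fin 3 → ℂ) →ₗ[ℂ] (Fin 3 → ℂ), Function.Surjective π ∧
    LinearMap.ker π = mcKernel B ∧
    ∀ i v, π (Pi.single i (convRow c s B i v)) = (C i).mulVec (π v)

/-- The tuples that arise as residues of the systems under consideration. -/
structure MCData (c s : ℂ) (B : Fin 3 → Matrix (Fin 3) (Fin 3) ℂ) : Prop where
  c_ne_zero : c ≠ 0
  s_ne_zero : s ≠ 0
  sum_eq : c • ∑ i, B i = -s • (1 : Matrix (Fin 3) (Fin 3) ℂ)
  kerLine : ∀ i, KerLine (B i)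

namespace MCData

variable {c s : ℂ} {B C C' : Fin 3 → Matrix (Fin 3) (Fin 3) ℂ}

theorem sum_mulVec (h : MCData c s B) (u : Fin 3 → ℂ) :
    c • ∑ i, (B i).mulVec u = -s • u := by
  rw [← Matrix.sum_mulVec, ← Matrix.smul_mulVec, h.sum_eq, Matrix.smul_mulVec, Matrix.one_mulVec]

/-- A common kernel vector is killed by the nonzero scalar c ∑ B_i = -s. In other words 𝒦 and ℒ meet
trivially. -/
theorem eq_zero_of_mulVec (h : MCData c s B) {u : Fin 3 → ℂ} (hu : ∀ i, (B i).mulVec u = 0) :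
    u = 0 := by
  have := h.sum_mulVec u
  simp only [hu, Finset.sum_const_zero, smul_zero] at this
  exact (smul_eq_zero_iff_right (neg_ne_zero.2 h.s_ne_zero)).1 this.symm

/-- If B_j v_j = B_j u for all j, the i-th row evaluates to c ∑ B_j u + s v_i = s (v_i - u). This
gives invariance of 𝒦 + ℒ and later makes the maps v ↦ B_i(row_i v) well defined on the quotient. -/
theorem mulVec_convRow_eq_zero (h : MCData c s B) {v : Fin 3 → Fin 3 → ℂ} (hv : v ∈ mcKernel B)
    (i : Fin 3) : (B i).mulVec (convRow c s B i v) = 0 := by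
  obtain ⟨u, hu⟩ := hv
  have h1 : ∀ j, (B j).mulVec (v j) = (B j).mulVec u := fun j => by
    rw [← sub_eq_zero, ← Matrix.mulVec_sub, hu]
  rw [convRow_apply, Finset.sum_congr rfl fun j _ => h1 j, h.sum_mulVec, Matrix.mulVec_add,
    Matrix.mulVec_smul, Matrix.mulVec_smul, h1, neg_smul, neg_add_cancel]

theorem single_mem_mcKernel {i : Fin 3} {u : Fin 3 → ℂ} (hu : (B i).mulVec u = 0) :
    (Pi.single i u : Fin 3 → Fin 3 → ℂ) ∈ mcKernel B := by
  refine ⟨0, fun j => ?_⟩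
  rcases eq_or_ne j i with rfl | hj
  · simpa using hu
  · simp [Pi.single_eq_of_ne hj]

theorem single_convRow_mem (h : MCData c s B) {v : Fin 3 → Fin 3 → ℂ} (hv : v ∈ mcKernel B)
    (i : Fin 3) : (Pi.single i (convRow c s B i v) : Fin 3 → Fin 3 → ℂ) ∈ mcKernel B :=
  single_mem_mcKernel (h.mulVec_convRow_eq_zero hv i)

/-- The vectors v_i = t_i k_i + u, with k_i spanning Ker B_i, are parametrized injectively by three
scalars t_i and one vector u. -/
theorem finrank_mcKernel (h : MCData c s B) : Module.finrank ℂ (mcKernel B) = 6 := by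
  choose k hk0 hk using h.kerLine
  let J : ((Fin 3 → ℂ) × (Fin 3 → ℂ)) →ₗ[ℂ] (Fin 3 → Fin 3 → ℂ) :=
    { toFun := fun p i => p.1 i • k i + p.2
      map_add' := fun p p' => by
        ext i a
        simp
        ring
      map_smul' := fun t p => by
        ext i a
        simp
        ring }
  have hJ : ∀ p i, J p i = p.1 i • k i + p.2 := fun _ _ => rfl
  have hinj : Function.Injective J := by
    rw [← LinearMap.ker_eq_bot, LinearMap.ker_eq_bot']
    intro p hp
    have h1 : ∀ i, p.1 i • k i + p.2 = 0 := fun i => by rw [← hJ, hp]; rfl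
    have h2 : p.2 = 0 := h.eq_zero_of_mulVec fun i =>
      (hk i _).2 ⟨-p.1 i, by rw [neg_smul]; exact eq_neg_of_add_eq_zero_right (h1 i)⟩
    refine Prod.ext (funext fun i => ?_) h2
    have h3 := h1 i
    rw [h2, add_zero] at h3
    exact (smul_eq_zero_iff_left (hk0 i)).1 h3
  have hr : LinearMap.range J = mcKernel B := by
    ext v
    constructor
    · rintro ⟨p, rfl⟩
      exact ⟨p.2, fun i => (hk i _).2 ⟨p.1 i, by rw [hJ, add_sub_cancel_right]⟩⟩
    · rintro ⟨u, hu⟩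
      choose t ht using fun i => (hk i _).1 (hu i)
      exact ⟨(t, u), funext fun i => by rw [hJ, ← ht, sub_add_cancel]⟩
  rw [← hr, LinearMap.finrank_range_of_inj hinj]
  simp

theorem exists_surjective (h : MCData c s B) :
    ∃ π : (Fin 3 → Fin 3 → ℂ) →ₗ[ℂ] (Fin 3 → ℂ), Function.Surjective π ∧
      LinearMap.ker π = mcKernel B := by
  have h1 : Module.finrank ℂ ((Fin 3 → Fin 3 → ℂ) ⧸ mcKernel B) = Module.finrank ℂ (Fin 3 → ℂ) := by
    have := Submodule.finrank_quotient_add_finrank (mcKernel B)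
    rw [h.finrank_mcKernel, Module.finrank_pi_fintype] at this
    simp at this ⊢
    omega
  let E := LinearEquiv.ofFinrankEq _ _ h1
  refine ⟨E.toLinearMap ∘ₗ (mcKernel B).mkQ, E.surjective.comp (Submodule.mkQ_surjective _), ?_⟩
  rw [LinearEquiv.ker_comp, Submodule.ker_mkQ]

/-- The induced endomorphism may be computed on any lift, since two lifts differ by an element of
the invariant subspace. The explicit formula serves for existence and for rationality. -/
theorem isMC_of_section (h : MCData c s B) {π : (Fin 3 → Fin 3 → ℂ) →ₗ[ℂ] (Fin 3 → ℂ)}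
    (hker : LinearMap.ker π = mcKernel B) {σ : (Fin 3 → ℂ) →ₗ[ℂ] (Fin 3 → Fin 3 → ℂ)}
    (hσ : ∀ a, π (σ a) = a) :
    IsMC c s B fun i => LinearMap.toMatrix'
      (π ∘ₗ LinearMap.single ℂ (fun _ => Fin 3 → ℂ) i ∘ₗ convRow c s B i ∘ₗ σ) := by
  refine ⟨π, fun a => ⟨σ a, hσ a⟩, hker, fun i v => ?_⟩
  rw [← Matrix.toLin'_apply, Matrix.toLin'_toMatrix']
  simp only [LinearMap.comp_apply, LinearMap.coe_single]
  rw [← sub_eq_zero, ← map_sub, ← LinearMap.mem_ker, hker, ← Pi.single_sub, ← map_sub]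
  refine h.single_convRow_mem ?_ i
  rw [← hker, LinearMap.mem_ker, map_sub, hσ, sub_self]

theorem exists_isMC (h : MCData c s B) : ∃ C, IsMC c s B C := by
  obtain ⟨π, hπ, hker⟩ := h.exists_surjective
  obtain ⟨σ, hσ⟩ := π.exists_rightInverse_of_surjective (LinearMap.range_eq_top.2 hπ)
  exact ⟨_, h.isMC_of_section hker fun a => LinearMap.congr_fun hσ a⟩

end MCData

/-- The middle convolution is unique up to simultaneous conjugation. -/
theorem IsMC.unique {c s : ℂ} {B C C' : Fin 3 → Matrix (Fin 3) (Fin 3) ℂ} (h : IsMC c s B C)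
    (h' : IsMC c s B C') : ∃ G : GL (Fin 3) ℂ, ∀ i,
      (↑G⁻¹ : Matrix (Fin 3) (Fin 3) ℂ) * C i * (G : Matrix (Fin 3) (Fin 3) ℂ) = C' i := by
  obtain ⟨π, hπ, hker, hC⟩ := h
  obtain ⟨π', hπ', hker', hC'⟩ := h'
  let E : (Fin 3 → ℂ) ≃ₗ[ℂ] (Fin 3 → ℂ) := (π'.quotKerEquivOfSurjective hπ').symm ≪≫ₗ
    Submodule.quotEquivOfEq _ _ (hker'.trans hker.symm) ≪≫ₗ π.quotKerEquivOfSurjective hπ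
  have hE : ∀ v, E (π' v) = π v := fun v => by
    have : (π'.quotKerEquivOfSurjective hπ').symm (π' v) = Submodule.Quotient.mk v := by
      rw [LinearEquiv.symm_apply_eq]
      rfl
    simp only [E, LinearEquiv.trans_apply, this]
    rfl
  let G : GL (Fin 3) ℂ := ⟨LinearMap.toMatrix' E.toLinearMap, LinearMap.toMatrix' E.symm.toLinearMap,
    by rw [← LinearMap.toMatrix'_comp]; simp, by rw [← LinearMap.toMatrix'_comp]; simp⟩
  have hG : ∀ v, (G : Matrix (Fin 3) (Fin 3) ℂ).mulVec v = E v := fun v =>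
    LinearMap.toMatrix'_mulVec _ _
  refine ⟨G, fun i => ?_⟩
  rw [mul_assoc, Units.inv_mul_eq_iff_eq_mul]
  refine Matrix.ext_of_mulVec_single fun j => ?_
  obtain ⟨v, hv⟩ := hπ' (Pi.single j 1)
  rw [← hv, ← Matrix.mulVec_mulVec, ← Matrix.mulVec_mulVec, hG, hE, ← hC, ← hC', hG, hE]

/-- Permuting and conjugating the tuple `B`. -/
theorem IsMC.transfer {c s : ℂ} {B B' C' : Fin 3 → Matrix (Fin 3) (Fin 3) ℂ}
    (h : IsMC c s B' C') (G : GL (Fin 3) ℂ) (τ : Equiv.Perm (Fin 3))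
    (hB : ∀ i, B' i = (↑G⁻¹ : Matrix (Fin 3) (Fin 3) ℂ) * B (τ i) * (G : Matrix (Fin 3) (Fin 3) ℂ)) :
    IsMC c s B (C' ∘ τ.symm) := by
  obtain ⟨π, hπ, hker, hC⟩ := h
  -- T applies G⁻¹ in each block and moves block τ i to block i; it carries the subspace and rows of
  -- B to those of B'.
  let T : (Fin 3 → Fin 3 → ℂ) →ₗ[ℂ] (Fin 3 → Fin 3 → ℂ) :=
    LinearMap.pi fun i => (↑G⁻¹ : Matrix (Fin 3) (Fin 3) ℂ).mulVecLin ∘ₗ LinearMap.proj (τ i)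
  have hT : ∀ v i, T v i = (↑G⁻¹ : Matrix (Fin 3) (Fin 3) ℂ).mulVec (v (τ i)) := fun _ _ => rfl
  have hGG : ∀ u, (G : Matrix (Fin 3) (Fin 3) ℂ).mulVec
      ((↑G⁻¹ : Matrix (Fin 3) (Fin 3) ℂ).mulVec u) = u := fun u => by
    rw [Matrix.mulVec_mulVec, Units.mul_inv, Matrix.one_mulVec]
  have hGG' : ∀ u, (↑G⁻¹ : Matrix (Fin 3) (Fin 3) ℂ).mulVec
      ((G : Matrix (Fin 3) (Fin 3) ℂ).mulVec u) = u := fun u => by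
    rw [Matrix.mulVec_mulVec, Units.inv_mul, Matrix.one_mulVec]
  have hBu : ∀ i u, (B' i).mulVec ((↑G⁻¹ : Matrix (Fin 3) (Fin 3) ℂ).mulVec u) =
      (↑G⁻¹ : Matrix (Fin 3) (Fin 3) ℂ).mulVec ((B (τ i)).mulVec u) := fun i u => by
    rw [hB, ← Matrix.mulVec_mulVec, hGG, ← Matrix.mulVec_mulVec]
  refine ⟨π ∘ₗ T, hπ.comp fun w => ⟨fun i => (G : Matrix (Fin 3) (Fin 3) ℂ).mulVec (w (τ.symm i)),
    funext fun i => ?_⟩, ?_, fun i v => ?_⟩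
  · rw [hT, hGG', Equiv.symm_apply_apply]
  · ext v
    rw [LinearMap.ker_comp, hker, Submodule.mem_comap, mem_mcKernel, mem_mcKernel]
    constructor
    · rintro ⟨u, hu⟩
      refine ⟨(G : Matrix (Fin 3) (Fin 3) ℂ).mulVec u, fun i => ?_⟩
      have := hu (τ.symm i)
      rw [hT, ← hGG' u, ← Matrix.mulVec_sub, hBu, Equiv.apply_symm_apply] at this
      rw [← hGG ((B i).mulVec _), this, Matrix.mulVec_zero]
    · rintro ⟨u, hu⟩
      refine ⟨(↑G⁻¹ : Matrix (Fin 3) (Fin 3) ℂ).mulVec u, fun i => ?_⟩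
      rw [hT, ← Matrix.mulVec_sub, hBu, hu, Matrix.mulVec_zero]
  · simp only [LinearMap.comp_apply, Function.comp_apply]
    rw [← hC]
    congr 1
    funext j
    rw [hT]
    rcases eq_or_ne (τ j) i with rfl | hj
    · rw [Pi.single_eq_same, Equiv.symm_apply_apply, Pi.single_eq_same, convRow_apply,
        convRow_apply, Matrix.mulVec_add, Matrix.mulVec_smul, Matrix.mulVec_smul, hT,
        Matrix.mulVec_sum]
      simp only [hT, hBu]
      rw [Equiv.sum_comp τ fun k => (↑G⁻¹ : Matrix (Fin 3) (Fin 3) ℂ).mulVec ((B k).mulVec (v k))]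
    · rw [Pi.single_eq_of_ne hj, Matrix.mulVec_zero, Pi.single_eq_of_ne]
      rintro rfl
      simp at hj

/-! ### The transformation `s_0` in terms of concrete models -/

namespace QSystem

/-- `q ^ λ = (κ e_1 e_2 e_3)⁻¹`. -/
def mcParam (d : QSystem) : ℂ := (d.κ * d.prod₃)⁻¹

/-- `[λ]`, where `q ^ λ = (κ e_1 e_2 e_3)⁻¹`. -/
def mcNumber (q : ℂ) (d : QSystem) : ℂ := (1 - d.mcParam) / (1 - q)

/-- The systems to which `s_0` can be applied. -/
structure Admissible (d : QSystem) : Prop where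
  isE8 : d.IsE8
  ne_one : d.κ * d.prod₃ ≠ 1
  ne_e : ∀ i j : Fin 9, (i : ℕ) < 3 → 3 ≤ (j : ℕ) → d.κ * d.prod₃ * d.e j ≠ d.e i

theorem prod₃_eq (d : QSystem) : d.prod₃ = d.e 0 * d.e 1 * d.e 2 := by
  rw [prod₃, Fin.prod_univ_three]
  rfl

/-- For i among the first three indices, e_i cancels from κ e_1 e_2 e_3 e_j = e_i, leaving κ e_k e_l
e_j = 1 with k, l the other two. -/
theorem IsE8.admissible {d : QSystem} (hd : d.IsE8) (h : d.NonResonant) : d.Admissible := by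
  have hρ := h 0 1 2 (by decide) (by decide) (by decide)
  refine ⟨hd, fun h1 => hρ ?_, fun i j hi hj h1 => ?_⟩
  · rw [← h1, prod₃_eq]
    ring
  · have hk : ∃ k l : Fin 9, (k : ℕ) < 3 ∧ (l : ℕ) < 3 ∧ k ≠ l ∧ d.prod₃ = d.e i * d.e k * d.e l := by
      rw [prod₃_eq]
      have hi' : i = 0 ∨ i = 1 ∨ i = 2 := by omega
      rcases hi' with rfl | rfl | rfl
      · exact ⟨1, 2, by decide, by decide, by decide, rfl⟩
      · exact ⟨0, 2, by decide, by decide, by decide, by ring⟩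
      · exact ⟨0, 1, by decide, by decide, by decide, by ring⟩
    obtain ⟨k, l, hk, hl, hkl, hE⟩ := hk
    refine h k l j hkl (fun h => by omega) (fun h => by omega) ?_
    refine mul_left_cancel₀ (hd.e_ne_zero i) ?_
    rw [hE] at h1
    linear_combination h1

variable {d : QSystem}

theorem IsE8.mcParam_ne_zero (hd : d.IsE8) : d.mcParam ≠ 0 :=
  inv_ne_zero (mul_ne_zero hd.κ_ne_zero hd.prod₃_ne_zero)

theorem Admissible.mcNumber_ne_zero {q : ℂ} (hq : 1 - q ≠ 0) (hd : d.Admissible) :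
    d.mcNumber q ≠ 0 := by
  refine div_ne_zero (sub_ne_zero.2 fun h => hd.ne_one ?_) hq
  rw [← inv_inv (d.κ * d.prod₃)]
  change d.mcParam⁻¹ = 1
  rw [← h, inv_one]

theorem Admissible.mcData {q : ℂ} (hq : 1 - q ≠ 0) (hd : d.Admissible)
    {B : Fin 3 → Matrix (Fin 3) (Fin 3) ℂ} (hB : ∀ x, d.at' x = fuchsVal q d.e₃ B x) :
    MCData d.mcParam (d.mcNumber q) B where
  c_ne_zero := hd.isE8.mcParam_ne_zero
  s_ne_zero := hd.mcNumber_ne_zero hq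
  sum_eq := by
    rw [hd.isE8.sum_residues hq hB, smul_smul, mcNumber, mcParam]
    congr 1
    have := hd.isE8.κ_ne_zero
    have := hd.isE8.prod₃_ne_zero
    field_simp
    ring
  kerLine := hd.isE8.kerLine_residue hq hB

end QSystem

theorem qConv_toLin'_apply {q lam c s : ℂ} (hc : q ^ lam = c) (hs : s = (1 - c) / (1 - q))
    (B : Fin 3 → Matrix (Fin 3) (Fin 3) ℂ) (i : Fin 3) (v : Fin 3 → Fin 3 → ℂ) :
    qConv q lam (fun i => Matrix.toLin' (B i)) i v = Pi.single i (convRow c s B i v) := by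
  rw [qConv_apply, convRow_apply, qNumber, hc, ← hs, Finset.smul_sum]
  simp only [Matrix.toLin'_apply]

/-- For v in ℒ every component equals -s⁻¹ c ∑ B_j v_j, so v is diagonal. Conversely every diagonal
vector lies in ℒ because c ∑ B_j = -s. -/
theorem mcK_sup_mcL {q lam c s : ℂ} (hc : q ^ lam = c) (hs : s = (1 - c) / (1 - q))
    {B : Fin 3 → Matrix (Fin 3) (Fin 3) ℂ} (h : MCData c s B) :
    mcK (fun i => Matrix.toLin' (B i)) ⊔ mcL q lam (fun i => Matrix.toLin' (B i)) =
      mcKernel B := by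
  have hL : ∀ v, v ∈ mcL q lam (fun i => Matrix.toLin' (B i)) ↔
      ∀ i, convRow c s B i v = 0 := fun v => by
    rw [mcL, LinearMap.mem_ker, LinearMap.sum_apply]
    simp only [qConv_toLin'_apply hc hs, Finset.univ_sum_single, funext_iff (f := fun _ => _)]
    rfl
  have hK : ∀ v, v ∈ mcK (fun i => Matrix.toLin' (B i)) ↔ ∀ i, (B i).mulVec (v i) = 0 := fun v => by
    simp [mcK, Submodule.mem_pi]
  refine le_antisymm (sup_le (fun v hv => ?_) fun v hv => ?_) fun v hv => ?_
  · exact ⟨0, by simpa using (hK v).1 hv⟩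
  · rw [hL] at hv
    refine ⟨-(s⁻¹ • c • ∑ j, (B j).mulVec (v j)), fun i => ?_⟩
    have h1 := hv i
    rw [convRow_apply] at h1
    rw [eq_neg_of_add_eq_zero_left h1, smul_neg, neg_neg, smul_smul, inv_mul_cancel₀ h.s_ne_zero,
      one_smul, sub_self, Matrix.mulVec_zero]
  · obtain ⟨u, hu⟩ := hv
    have : v = (fun i => v i - u) + fun _ => u := by
      funext i
      simp
    rw [this]
    refine Submodule.add_mem_sup ((hK _).2 hu) ((hL _).2 fun i => ?_)
    rw [convRow_apply, h.sum_mulVec, neg_smul, neg_add_cancel]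

theorem exists_cpow_eq {q : ℂ} (hq0 : 0 < ‖q‖) (hq1 : ‖q‖ < 1) {c : ℂ} (hc : c ≠ 0) :
    ∃ lam : ℂ, q ^ lam = c := by
  have h0 : q ≠ 0 := norm_pos_iff.1 hq0
  have hlog : Complex.log q ≠ 0 := fun h => by
    rw [← Complex.exp_log h0, h, Complex.exp_zero] at hq1
    simp at hq1
  refine ⟨Complex.log c / Complex.log q, ?_⟩
  rw [Complex.cpow_def_of_ne_zero h0, mul_div_cancel₀ _ hlog, Complex.exp_log hc]

/-- Infinite products, the exponent λ and the abstract quotient disappear here: a basis of the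
quotient is the same as a surjection onto ℂ³ with kernel 𝒦 + ℒ, and λ enters only through q^λ. -/
theorem isS0_iff {q : ℂ} (hq0 : 0 < ‖q‖) (hq1 : ‖q‖ < 1) {d : QSystem} (hd : d.Admissible)
    {b : QSystem} :
    IsS0 q d b ↔ (∀ i : Fin 9, b.e i = if (i : ℕ) < 3 then d.e i else d.κ * d.prod₃ * d.e i) ∧
      b.κ = (d.κ * d.prod₃ ^ 2)⁻¹ ∧ ∃ B C : Fin 3 → Matrix (Fin 3) (Fin 3) ℂ,
        (∀ x, d.at' x = fuchsVal q d.e₃ B x) ∧ (∀ x, b.at' x = fuchsVal q d.e₃ C x) ∧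
        IsMC d.mcParam (d.mcNumber q) B C := by
  have h1q := one_sub_ne_zero_of_norm_lt_one hq1
  refine and_congr_right fun _ => and_congr_right fun _ => ?_
  constructor
  · rintro ⟨B, lam, ψ, hB, hlam, hb⟩
    change q ^ lam = d.mcParam at hlam
    rw [isResidueTuple_iff hq1 hd.isE8.e₃_ne_zero] at hB
    rw [s0_matrix_iff hq1 hd.isE8.e₃_ne_zero] at hb
    refine ⟨B, _, hB, hb, ψ.toLinearMap ∘ₗ Submodule.mkQ _,
      ψ.surjective.comp (Submodule.mkQ_surjective _), ?_, fun i v => ?_⟩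
    · rw [LinearEquiv.ker_comp, Submodule.ker_mkQ, mcK_sup_mcL hlam rfl (hd.mcData h1q hB)]
    · rw [← Matrix.toLin'_apply, Matrix.toLin'_toMatrix', 
        ← qConv_toLin'_apply hlam (s := d.mcNumber q) rfl]
      simp [LinearEquiv.conj_apply, qMC]
  · rintro ⟨B, C, hB, hb, π, hπ, hker, hC⟩
    obtain ⟨lam, hlam⟩ := exists_cpow_eq hq0 hq1 hd.isE8.mcParam_ne_zero
    have hK := mcK_sup_mcL hlam rfl (hd.mcData h1q hB)
    let ψ : MCSpace q lam (fun i => Matrix.toLin' (B i)) ≃ₗ[ℂ] (Fin 3 → ℂ) :=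
      Submodule.quotEquivOfEq _ _ (hK.trans hker.symm) ≪≫ₗ π.quotKerEquivOfSurjective hπ
    have hψ : ∀ v, ψ (Submodule.Quotient.mk v) = π v := fun v => rfl
    refine ⟨B, lam, ψ, (isResidueTuple_iff hq1 hd.isE8.e₃_ne_zero).2 hB, hlam, ?_⟩
    have hCi : C = fun i => LinearMap.toMatrix'
        (ψ.conj (qMC q lam (fun i => Matrix.toLin' (B i)) i)) := by
      funext i
      rw [← LinearMap.toMatrix'_toLin' (C i)]
      congr 1
      refine LinearMap.ext fun w => ?_
      obtain ⟨v, rfl⟩ := hπ w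
      have : ψ.symm (π v) = Submodule.Quotient.mk v := by
        rw [LinearEquiv.symm_apply_eq, hψ]
      rw [Matrix.toLin'_apply, ← hC, LinearEquiv.conj_apply, LinearMap.comp_apply,
        LinearMap.comp_apply, LinearEquiv.coe_coe, LinearEquiv.coe_coe, this, qMC,
        Submodule.mapQ_apply, hψ, qConv_toLin'_apply hlam rfl]
      rfl
    rw [← hCi]
    exact (s0_matrix_iff hq1 hd.isE8.e₃_ne_zero).2 hb

theorem exists_isS0 {q : ℂ} (hq0 : 0 < ‖q‖) (hq1 : ‖q‖ < 1) {d : QSystem} (hd : d.Admissible) :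
    ∃ b, IsS0 q d b := by
  have h1q := one_sub_ne_zero_of_norm_lt_one hq1
  have hB := hd.isE8.exists_fuchsVal h1q
  obtain ⟨C, hC⟩ := (hd.mcData h1q hB).exists_isMC
  refine ⟨⟨fun i => if (i : ℕ) < 3 then d.e i else d.κ * d.prod₃ * d.e i, (d.κ * d.prod₃ ^ 2)⁻¹,
    fuchsPoly q d.e₃ C⟩, (isS0_iff hq0 hq1 hd).2 ⟨fun i => rfl, rfl, _, C, hB, fun x => ?_, hC⟩⟩
  exact fuchsPoly_map_eval q d.e₃ C x

/-! ### The determinant of `s_0 . A` -/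

theorem natDegree_det_le {M : Matrix (Fin 3) (Fin 3) ℂ[X]} (hM : ∀ i j, (M i j).natDegree ≤ 3) :
    M.det.natDegree ≤ 9 := by
  rw [Matrix.det_apply']
  refine natDegree_sum_le_of_forall_le _ _ fun σ _ => ?_
  rw [← C_eq_intCast]
  refine (natDegree_C_mul_le _ _).trans ((natDegree_prod_le _ _).trans ?_)
  refine (Finset.sum_le_sum fun i _ => hM (σ i) i).trans ?_
  simp

theorem coeff_det {M : Matrix (Fin 3) (Fin 3) ℂ[X]} (hM : ∀ i j, (M i j).natDegree ≤ 3) :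
    M.det.coeff 9 = (M.map fun p => p.coeff 3).det := by
  have h : ∀ σ : Equiv.Perm (Fin 3), (∏ i, M (σ i) i).coeff 9 = ∏ i, (M (σ i) i).coeff 3 :=
    fun σ => by
      have := coeff_prod_of_natDegree_le (s := Finset.univ) (fun i => M (σ i) i) 3
        fun i _ => hM _ _
      simpa using this
  rw [Matrix.det_apply', Matrix.det_apply', finsetSum_coeff]
  refine Finset.sum_congr rfl fun σ _ => ?_
  rw [← C_eq_intCast, coeff_C_mul, h]
  simp

/-- Both sides have degree at most 9 and the same coefficient of x⁹, so their difference has degree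
less than 9 but nine distinct zeros. -/
theorem det_eq_of_roots {A₁ A₂ : Matrix (Fin 3) (Fin 3) ℂ} {κ : ℂ} {e : Fin 9 → ℂ}
    (he : Function.Injective e) {A : ℂ → Matrix (Fin 3) (Fin 3) ℂ}
    (hA : ∀ x, A x = 1 + x • A₁ + x ^ 2 • A₂ + (κ * x ^ 3) • (1 : Matrix (Fin 3) (Fin 3) ℂ))
    (hroot : ∀ i, (A (-e i)).det = 0) (x : ℂ) : (A x).det = κ ^ 3 * ∏ i, (x + e i) := by
  let M : Matrix (Fin 3) (Fin 3) ℂ[X] := Matrix.of fun i j =>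
    C ((1 : Matrix (Fin 3) (Fin 3) ℂ) i j) + C (A₁ i j) * X + C (A₂ i j) * X ^ 2 +
      C ((κ • (1 : Matrix (Fin 3) (Fin 3) ℂ)) i j) * X ^ 3
  have hM : ∀ i j, (M i j).natDegree ≤ 3 := fun i j => by
    simp only [M, Matrix.of_apply]
    compute_degree
  have heval : ∀ y, M.det.eval y = (A y).det := fun y => by
    rw [← coe_evalRingHom, RingHom.map_det]
    congr 1
    rw [hA]
    ext i j
    simp [M]
    ring
  let P : ℂ[X] := C (κ ^ 3) * ∏ i, (X + C (e i))
  have hP : (∏ i, (X + C (e i))).natDegree = 9 := by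
    rw [natDegree_prod_of_monic _ _ fun i _ => monic_X_add_C _]
    simp
  have hPc : P.coeff 9 = κ ^ 3 := by
    have : (∏ i, (X + C (e i))).coeff 9 = 1 := by
      have h1 : (∏ i, (X + C (e i))).Monic := monic_prod_of_monic _ _ fun i _ => monic_X_add_C _
      rw [Monic, leadingCoeff, hP] at h1
      exact h1
    rw [coeff_C_mul, this, mul_one]
  have hMc : M.det.coeff 9 = κ ^ 3 := by
    rw [coeff_det hM]
    have : (M.map fun p => p.coeff 3) = κ • (1 : Matrix (Fin 3) (Fin 3) ℂ) := by
      ext i j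
      simp [-map_mul, M]
    rw [this, Matrix.det_smul]
    simp
  have hMP : M.det = P := by
    refine eq_of_degree_sub_lt_of_eval_finset_eq (Finset.univ.image fun i => -e i) ?_ ?_
    · rw [Finset.card_image_of_injective _ fun _ _ h => he (neg_injective h), Finset.card_univ,
        Fintype.card_fin, degree_lt_iff_coeff_zero]
      intro m hm
      rw [coeff_sub]
      rcases hm.eq_or_lt with rfl | hm
      · rw [hPc, hMc, sub_self]
      · rw [coeff_eq_zero_of_natDegree_lt ((natDegree_det_le hM).trans_lt hm),
          coeff_eq_zero_of_natDegree_lt, sub_self]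
        exact (natDegree_C_mul_le _ _).trans_lt (by rw [hP]; exact hm)
    · simp only [Finset.mem_image, Finset.mem_univ, true_and, forall_exists_index]
      rintro _ i rfl
      rw [heval, hroot]
      simp only [P, eval_mul, eval_prod, eval_add, eval_X, eval_C]
      rw [Finset.prod_eq_zero (Finset.mem_univ i) (by simp), mul_zero]
  rw [← heval, hMP]
  simp [P, eval_prod]

namespace IsMC

variable {c s : ℂ} {B C : Fin 3 → Matrix (Fin 3) (Fin 3) ℂ}

/-- On V³ the sum of the convolution matrices is s plus a map into the diagonal, which vanishes in
the quotient. -/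
theorem sum_eq (hC : IsMC c s B C) :
    ∑ i, C i = s • (1 : Matrix (Fin 3) (Fin 3) ℂ) := by
  obtain ⟨π, hπ, hker, hC⟩ := hC
  refine Matrix.ext_of_mulVec_single fun j => ?_
  obtain ⟨v, hv⟩ := hπ (Pi.single j 1)
  rw [← hv, Matrix.sum_mulVec, Matrix.smul_mulVec, Matrix.one_mulVec]
  simp only [← hC]
  rw [← map_sum, Finset.univ_sum_single (fun i => convRow c s B i v), ← map_smul, ← sub_eq_zero,
    ← map_sub, ← LinearMap.mem_ker, hker]
  refine ⟨c • ∑ j, (B j).mulVec (v j), fun i => ?_⟩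
  simp [convRow_apply]

/-- The image of C_i lies in the image of the i-th block, and the block map V → V³/(𝒦 + ℒ) kills the
line Ker B_i, so the rank is at most 2. -/
theorem det_eq_zero (h : MCData c s B) (hC : IsMC c s B C) (i : Fin 3) : (C i).det = 0 := by
  obtain ⟨π, hπ, hker, hC⟩ := hC
  by_contra hdet
  let ι : (Fin 3 → ℂ) →ₗ[ℂ] (Fin 3 → ℂ) := π ∘ₗ LinearMap.single ℂ (fun _ => Fin 3 → ℂ) i
  have hsurj : Function.Surjective ι := fun w => by
    obtain ⟨v, hv⟩ := hπ ((C i)⁻¹.mulVec w)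
    refine ⟨convRow c s B i v, ?_⟩
    change π (Pi.single i _) = w
    rw [hC, hv, Matrix.mulVec_mulVec, Matrix.mul_nonsing_inv _ (isUnit_iff_ne_zero.2 hdet),
      Matrix.one_mulVec]
  obtain ⟨k, hk0, hk⟩ := h.kerLine i
  have hBk : (B i).mulVec k = 0 := (hk k).2 ⟨1, (one_smul _ _).symm⟩
  refine hk0 (LinearMap.injective_iff_surjective.2 hsurj ?_)
  rw [map_zero]
  change π (Pi.single i k) = 0
  rw [← LinearMap.mem_ker, hker]
  exact MCData.single_mem_mcKernel hBk

/-- A zero `y = c x` of `det A` gives a zero `x` of `det (s_0 . A)`. -/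
theorem det_fuchsVal_eq_zero {q : ℂ} (h : MCData c s B) (hC : IsMC c s B C)
    (hs : (1 - q) * s = 1 - c) {e : Fin 3 → ℂ} (he : ∀ i, e i ≠ 0) {x : ℂ}
    (hx : ∀ i, x + e i ≠ 0) (hy : ∀ i, c * x + e i ≠ 0)
    (hdet : (fuchsVal q e B (c * x)).det = 0) : (fuchsVal q e C x).det = 0 := by
  obtain ⟨π, hπ, hker, hC⟩ := hC
  have hP : (∏ i, (1 + c * x / e i)) ≠ 0 := Finset.prod_ne_zero_iff.2 fun i _ h0 => hy i <| by
    have := he i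
    field_simp at h0
    linear_combination h0
  obtain ⟨v, hv0, hv⟩ := Matrix.exists_mulVec_eq_zero_iff.2 hdet
  rw [fuchsVal_eq he B hy, Matrix.smul_mulVec, smul_eq_zero_iff_right hP, Matrix.sub_mulVec,
    Matrix.one_mulVec, Matrix.smul_mulVec, Matrix.sum_mulVec, sub_eq_zero] at hv
  -- The lift of the new kernel vector; v = (1 - q) c x ∑ B_j w_j is the kernel equation at cx.
  let w : Fin 3 → Fin 3 → ℂ := fun i => (c * x + e i)⁻¹ • v
  have hw : ∀ i, (c * x + e i) • w i = v := fun i => by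
    simp only [w, smul_smul, mul_inv_cancel₀ (hy i), one_smul]
  set z := ∑ j, (B j).mulVec (w j) with hz
  have hvz : v = ((1 - q) * (c * x)) • z := by
    conv_lhs => rw [hv]
    rw [hz]
    congr 1
    refine Finset.sum_congr rfl fun j _ => ?_
    simp only [w, Matrix.smul_mulVec, Matrix.mulVec_smul]
  clear_value w
  rw [← Matrix.exists_mulVec_eq_zero_iff]
  refine ⟨π w, fun h0 => ?_, ?_⟩
  -- If w were zero in the quotient, v would be (c - 1) x u. Then (x + e_i) B_i u = 0 for all i,
  -- hence u = 0 and v = 0.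
  · rw [← LinearMap.mem_ker, hker] at h0
    obtain ⟨u, hu⟩ := h0
    have h1 : c • z = -s • u := by
      rw [← h.sum_mulVec, hz]
      congr 1
      refine Finset.sum_congr rfl fun j _ => ?_
      rw [← sub_eq_zero, ← Matrix.mulVec_sub, hu]
    have h2 : v = (c * x - x) • u := by
      rw [hvz, show (1 - q) * (c * x) = ((1 - q) * x) * c by ring, ← smul_smul, h1, smul_smul]
      congr 1
      linear_combination -x * hs
    have hu0 : u = 0 := h.eq_zero_of_mulVec fun i => by
      have h3 : (x + e i) • (B i).mulVec u = -((c * x + e i) • (B i).mulVec (w i - u)) := by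
        rw [← Matrix.mulVec_smul, ← Matrix.mulVec_smul, ← Matrix.mulVec_neg, smul_sub, hw, h2]
        congr 1
        module
      rw [hu, smul_zero, neg_zero] at h3
      exact (smul_eq_zero_iff_right (hx i)).1 h3
    exact hv0 (by rw [h2, hu0, smul_zero])
  · have h1 : w = ((1 - q) * x) • fun i => (x + e i)⁻¹ • convRow c s B i w := by
      funext i
      -- Subtracting (c - 1) x w_i from (cx + e_i) w_i = v and using (1 - q) s = 1 - c gives the
      -- kernel equation at x.
      have h2 : (x + e i) • w i = ((1 - q) * x) • convRow c s B i w := by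
        rw [convRow_apply, ← hz, smul_add, smul_smul, smul_smul,
          show (1 - q) * x * c = (1 - q) * (c * x) by ring, ← hvz, ← hw i, ← add_smul]
        congr 1
        linear_combination -x * hs
      rw [Pi.smul_apply, smul_comm, ← h2, smul_smul, inv_mul_cancel₀ (hx i), one_smul]
    rw [fuchsVal_eq he C hx, Matrix.smul_mulVec, Matrix.sub_mulVec, Matrix.one_mulVec,
      Matrix.smul_mulVec, Matrix.sum_mulVec]
    conv_lhs => enter [2, 1]; rw [h1]
    rw [map_smul, ← Finset.univ_sum_single (fun i => (x + e i)⁻¹ • convRow c s B i w), map_sum]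
    simp only [Pi.single_smul', map_smul, hC, Matrix.smul_mulVec]
    simp

end IsMC

namespace QSystem

theorem Admissible.injective_s0 {d b : QSystem} (hd : d.Admissible)
    (hb : ∀ i : Fin 9, b.e i = if (i : ℕ) < 3 then d.e i else d.κ * d.prod₃ * d.e i) :
    Function.Injective b.e := by
  have hρ : d.κ * d.prod₃ ≠ 0 := mul_ne_zero hd.isE8.κ_ne_zero hd.isE8.prod₃_ne_zero
  intro i j hij
  rw [hb, hb] at hij
  split_ifs at hij with hi hj hj
  · exact hd.isE8.distinct hij
  · exact absurd hij.symm (hd.ne_e i j hi (not_lt.1 hj))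
  · exact absurd hij (hd.ne_e j i hj (not_lt.1 hi))
  · exact hd.isE8.distinct (mul_left_cancel₀ hρ hij)

theorem e₃_s0 {d b : QSystem}
    (hb : ∀ i : Fin 9, b.e i = if (i : ℕ) < 3 then d.e i else d.κ * d.prod₃ * d.e i) :
    b.e₃ = d.e₃ := by
  funext i
  rw [e₃, hb, if_pos (by simp)]
  rfl

theorem Admissible.isE8_s0 {q : ℂ} (hq0 : 0 < ‖q‖) (hq1 : ‖q‖ < 1) {d b : QSystem}
    (hd : d.Admissible) (h : IsS0 q d b) : b.IsE8 := by
  have h1q := one_sub_ne_zero_of_norm_lt_one hq1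
  obtain ⟨he, hκ, B, C, hB, hb, hC⟩ := (isS0_iff hq0 hq1 hd).1 h
  have hdat := hd.mcData h1q hB
  have hE := hd.isE8.prod₃_ne_zero
  have hκ0 := hd.isE8.κ_ne_zero
  have hs : (1 - q) * d.mcNumber q = 1 - d.mcParam := by
    rw [mcNumber]
    field_simp
  have hform : ∀ x, b.at' x = 1 + x • fuchsCoeff₁ q d.e₃ C + x ^ 2 • fuchsCoeff₂ q d.e₃ C +
      (b.κ * x ^ 3) • (1 : Matrix (Fin 3) (Fin 3) ℂ) := fun x => by
    rw [hb, fuchsVal]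
    congr 1
    rw [fuchsCoeff₃, hC.sum_eq, smul_smul (1 - q), hs, sub_smul, one_smul, sub_sub_cancel, smul_smul,
      smul_smul, hκ, mcParam]
    congr 1
    change _ * d.prod₃⁻¹ * _ = _
    field_simp
  have hinj := hd.injective_s0 he
  refine ⟨⟨_, _, hform⟩, det_eq_of_roots hinj hform fun j => ?_, hinj⟩
  rw [he, hb]
  split_ifs with hj
  · have : d.e j = d.e₃ ⟨j, hj⟩ := rfl
    rw [this, fuchsVal_neg hd.isE8.e₃_ne_zero, Matrix.det_smul, hC.det_eq_zero hdat, mul_zero]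
  -- The shift x ↦ cx sends the new zero -κ e_1 e_2 e_3 e_j back to the old zero -e_j.
  · have hy : d.mcParam * -(d.κ * d.prod₃ * d.e j) = -d.e j := by
      rw [mcParam]
      field_simp
    refine hC.det_fuchsVal_eq_zero hdat hs hd.isE8.e₃_ne_zero (fun i h0 => ?_)
      (fun i h0 => ?_) ?_
    · refine hd.ne_e (Fin.castLE (by norm_num) i) j (by simp) (not_lt.1 hj) ?_
      change _ = d.e₃ i
      linear_combination -h0
    · rw [hy] at h0
      have h2 : d.e (Fin.castLE (by norm_num) i) = d.e j := by
        change d.e₃ i = _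
        linear_combination h0
      have := hd.isE8.distinct h2
      rw [← this] at hj
      simp at hj
    · rw [hy, ← hB, hd.isE8.det_neg_e]

/-- The product κ e_1 e_2 e_3 is inverted by s_0, so the inequalities defining admissibility reduce
to κ e_1 e_2 e_3 ≠ 1 and the distinctness of the original e_i. -/
theorem Admissible.s0 {q : ℂ} (hq0 : 0 < ‖q‖) (hq1 : ‖q‖ < 1) {d b : QSystem}
    (hd : d.Admissible) (h : IsS0 q d b) : b.Admissible := by
  have he3 : b.prod₃ = d.prod₃ := by rw [prod₃, prod₃, e₃_s0 h.1]
  have hE := hd.isE8.prod₃_ne_zero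
  have hκ0 := hd.isE8.κ_ne_zero
  have hρ : b.κ * b.prod₃ = (d.κ * d.prod₃)⁻¹ := by
    rw [he3, h.2.1]
    field_simp
  refine ⟨hd.isE8_s0 hq0 hq1 h, ?_, fun i j hi hj => ?_⟩
  · rw [hρ, Ne, inv_eq_one]
    exact hd.ne_one
  · rw [hρ, h.1, h.1, if_pos hi, if_neg (not_lt.2 hj), inv_mul_cancel_left₀ (mul_ne_zero hκ0 hE)]
    intro h0
    have := hd.isE8.distinct h0
    omega

end QSystem

/-! ### Conjugation and permutation of the first three parameters -/

theorem fuchsVal_conj (q : ℂ) (e : Fin 3 → ℂ) (C : Fin 3 → Matrix (Fin 3) (Fin 3) ℂ)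
    (G : GL (Fin 3) ℂ) (x : ℂ) :
    fuchsVal q e (fun i => (↑G⁻¹ : Matrix (Fin 3) (Fin 3) ℂ) * C i * (G : Matrix _ _ ℂ)) x =
      (↑G⁻¹ : Matrix (Fin 3) (Fin 3) ℂ) * fuchsVal q e C x * (G : Matrix _ _ ℂ) := by
  have h1 : (↑G⁻¹ : Matrix (Fin 3) (Fin 3) ℂ) * (G : Matrix _ _ ℂ) = 1 := Units.inv_mul G
  simp only [fuchsVal, fuchsCoeff₁, fuchsCoeff₂, fuchsCoeff₃, mul_add, add_mul, mul_sub, sub_mul,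
    Matrix.mul_smul, Matrix.smul_mul, Finset.mul_sum, Finset.sum_mul, mul_one, h1]

theorem fuchsVal_perm (q : ℂ) (e : Fin 3 → ℂ) (C : Fin 3 → Matrix (Fin 3) (Fin 3) ℂ)
    (τ : Equiv.Perm (Fin 3)) (x : ℂ) : fuchsVal q (e ∘ τ) (C ∘ τ) x = fuchsVal q e C x := by
  have h1 : ∑ i, (e (τ i))⁻¹ = ∑ i, (e i)⁻¹ := Equiv.sum_comp τ fun i => (e i)⁻¹
  have h2 : ∑ i, (e (τ i))⁻¹ • C (τ i) = ∑ i, (e i)⁻¹ • C i :=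
    Equiv.sum_comp τ fun i => (e i)⁻¹ • C i
  have h3 : ∏ i, e (τ i) = ∏ i, e i := Equiv.prod_comp τ e
  have h4 : ∑ i, e (τ i) = ∑ i, e i := Equiv.sum_comp τ e
  have h5 : ∑ i, ((∑ j, e j) - e (τ i)) • C (τ i) = ∑ i, ((∑ j, e j) - e i) • C i :=
    Equiv.sum_comp τ fun i => ((∑ j, e j) - e i) • C i
  have h6 : ∑ i, C (τ i) = ∑ i, C i := Equiv.sum_comp τ C
  simp only [fuchsVal, fuchsCoeff₁, fuchsCoeff₂, fuchsCoeff₃, Function.comp_apply, h1, h2, h3, h4,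
    h5, h6]

/-- Residues are determined by the system, so those of d' are the conjugated and permuted residues
of d. The case τ = 1 gives invariance under ≃, the case G = 1 the commutation with the s_i. -/
theorem IsS0.exists_conj {q : ℂ} (hq0 : 0 < ‖q‖) (hq1 : ‖q‖ < 1) {d d' b b' : QSystem}
    (hd : d.Admissible) (hd' : d'.Admissible) (hκ : d'.κ = d.κ) (τ : Equiv.Perm (Fin 3))
    (he : d'.e₃ = d.e₃ ∘ τ) (G : GL (Fin 3) ℂ)
    (hG : ∀ x, (↑G⁻¹ : Matrix (Fin 3) (Fin 3) ℂ) * d.at' x * (G : Matrix _ _ ℂ) = d'.at' x)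
    (h : IsS0 q d b) (h' : IsS0 q d' b') :
    ∃ H : GL (Fin 3) ℂ, ∀ x,
      (↑H⁻¹ : Matrix (Fin 3) (Fin 3) ℂ) * b.at' x * (H : Matrix _ _ ℂ) = b'.at' x := by
  have h1q := one_sub_ne_zero_of_norm_lt_one hq1
  obtain ⟨-, -, B, C, hB, hb, hC⟩ := (isS0_iff hq0 hq1 hd).1 h
  obtain ⟨-, -, B', C', hB', hb', hC'⟩ := (isS0_iff hq0 hq1 hd').1 h'
  have hprod : d'.prod₃ = d.prod₃ := by
    rw [QSystem.prod₃, he]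
    exact Equiv.prod_comp τ d.e₃
  have hc : d'.mcParam = d.mcParam := by rw [QSystem.mcParam, QSystem.mcParam, hκ, hprod]
  rw [QSystem.mcNumber, hc] at hC'
  have hBB' : B' = (fun i => (↑G⁻¹ : Matrix (Fin 3) (Fin 3) ℂ) * B i * (G : Matrix _ _ ℂ)) ∘ τ := by
    refine fuchsVal_injective h1q hd'.isE8.e₃_ne_zero hd'.isE8.e₃_injective fun x => ?_
    rw [← hB', he, fuchsVal_perm, fuchsVal_conj, ← hB, hG]
  obtain ⟨H, hH⟩ := hC.unique (hC'.transfer G τ fun i => congrFun hBB' i)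
  refine ⟨H, fun x => ?_⟩
  rw [hb, hb', he, ← fuchsVal_conj, funext hH, ← fuchsVal_perm q d.e₃ _ τ]
  congr 1
  funext i
  simp

namespace QSystem

variable {d d' : QSystem}

theorem IsE8.conj (hd : d.IsE8) (h : d.Conj d') : d'.IsE8 := by
  obtain ⟨he, hκ, G, hG⟩ := h
  obtain ⟨A₁, A₂, hA⟩ := hd.form
  have h1 : (↑G⁻¹ : Matrix (Fin 3) (Fin 3) ℂ) * (G : Matrix _ _ ℂ) = 1 := Units.inv_mul G
  refine ⟨⟨(↑G⁻¹ : Matrix (Fin 3) (Fin 3) ℂ) * A₁ * (G : Matrix _ _ ℂ),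
    (↑G⁻¹ : Matrix (Fin 3) (Fin 3) ℂ) * A₂ * (G : Matrix _ _ ℂ), fun x => ?_⟩, fun x => ?_, ?_⟩
  · rw [← hG, hA, ← hκ]
    simp only [mul_add, add_mul, Matrix.mul_smul, Matrix.smul_mul, mul_one, h1]
  · rw [← hG, ← he, ← hκ, ← hd.det_eq, Matrix.det_mul, Matrix.det_mul, mul_right_comm,
      ← Matrix.det_mul, h1, Matrix.det_one, one_mul]
  · rw [← he]
    exact hd.distinct

theorem Admissible.conj (hd : d.Admissible) (h : d.Conj d') : d'.Admissible := by
  have hp : d'.prod₃ = d.prod₃ := by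
    rw [prod₃_eq, prod₃_eq, h.1]
  refine ⟨hd.isE8.conj h, ?_, ?_⟩
  · rw [hp, ← h.2.1]
    exact hd.ne_one
  · rw [hp, ← h.2.1, ← h.1]
    exact hd.ne_e

theorem IsE8.swap (hd : d.IsE8) (i : Fin 8) : (d.swap i).IsE8 := by
  refine ⟨hd.form, fun x => ?_, hd.distinct.comp (Equiv.injective _)⟩
  refine (hd.det_eq x).trans ?_
  congr 1
  exact (Equiv.prod_comp (Equiv.swap i.castSucc i.succ) fun j => x + d.e j).symm

theorem NonResonant.swap (h : d.NonResonant) (i : Fin 8) : (d.swap i).NonResonant :=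
  fun _ _ _ hjk hkl hlj => h _ _ _ ((Equiv.injective _).ne hjk) ((Equiv.injective _).ne hkl)
    ((Equiv.injective _).ne hlj)

/-- Only the transposition e_3 ↔ e_4, here of index 2, mixes the first three parameters with the
others. -/
theorem exists_perm_e₃_swap (d : QSystem) {i : Fin 8} (hi : i ≠ 2) :
    ∃ τ : Equiv.Perm (Fin 3), d.e₃ = (d.swap i).e₃ ∘ τ := by
  have h : ∀ i : Fin 8, i ≠ 2 → ∃ τ : Equiv.Perm (Fin 3), ∀ j : Fin 3,
      Equiv.swap i.castSucc i.succ (Fin.castLE (by norm_num) (τ j)) =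
        (Fin.castLE (by norm_num) j : Fin 9) := by
    decide
  obtain ⟨τ, hτ⟩ := h i hi
  refine ⟨τ, funext fun j => ?_⟩
  simp only [e₃, swap, Function.comp_apply, hτ]

theorem swap_lt_three_iff {i : Fin 8} (hi : i ≠ 2) (j : Fin 9) :
    (Equiv.swap i.castSucc i.succ j : ℕ) < 3 ↔ (j : ℕ) < 3 := by
  revert i j
  decide

end QSystem

theorem IsS0.conj_swap {q : ℂ} (hq0 : 0 < ‖q‖) (hq1 : ‖q‖ < 1) {d a b : QSystem}
    (hd : d.IsE8) (hres : d.NonResonant) {i : Fin 8} (hi : i ≠ 2)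
    (ha : IsS0 q (d.swap i) a) (hb : IsS0 q d b) : a.Conj (b.swap i) := by
  obtain ⟨τ, hτ⟩ := d.exists_perm_e₃_swap hi
  have hp : (d.swap i).prod₃ = d.prod₃ := by
    rw [QSystem.prod₃, QSystem.prod₃, hτ]
    exact (Equiv.prod_comp τ (d.swap i).e₃).symm
  refine ⟨funext fun j => ?_, ?_, ?_⟩
  · rw [ha.1, hp]
    simp only [QSystem.swap, Function.comp_apply]
    rw [hb.1]
    simp only [QSystem.swap_lt_three_iff hi]
  · rw [ha.2.1, hp]
    exact hb.2.1.symm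
  · exact ha.exists_conj (b' := b) hq0 hq1 ((hd.swap i).admissible (hres.swap i)) (hd.admissible hres) rfl τ
      hτ 1 (fun x => by simp [QSystem.swap, QSystem.at']) hb

/-! ### `s_0` is an involution -/

theorem mulVec_eq_zero_of_star {B : Fin 3 → Matrix (Fin 3) (Fin 3) ℂ}
    (h : Star fun i => Matrix.toLin' (B i)) {i : Fin 3} {τ : ℂ} {u : Fin 3 → ℂ}
    (hu : ∀ j ≠ i, (B j).mulVec u = 0) (hi : (B i).mulVec u + τ • u = 0) : u = 0 := by
  have := h i τ
  rw [← Submodule.mem_bot ℂ, ← this, Submodule.mem_inf]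
  refine ⟨?_, by simpa using hi⟩
  simp only [Submodule.mem_iInf]
  intro j hj
  simpa using hu j hj

/-- Up to the factor c, the row map restricts to B_j on block j ≠ i and to B_i + s/c on block i;
(∗∗) with τ = s/c says that these images span. -/
theorem MCData.convRow_surjective {c s : ℂ} {B : Fin 3 → Matrix (Fin 3) (Fin 3) ℂ}
    (h : MCData c s B) (hB : StarStar fun i => Matrix.toLin' (B i)) (i : Fin 3) :
    Function.Surjective (convRow c s B i) := by
  have hc := h.c_ne_zero
  rw [← LinearMap.range_eq_top, eq_top_iff, ← hB i (c⁻¹ * s)]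
  refine sup_le (iSup₂_le fun j hj => ?_) ?_
  · rintro _ ⟨w, rfl⟩
    refine ⟨Pi.single j (c⁻¹ • w), ?_⟩
    rw [convRow_apply, Finset.sum_eq_single j, Pi.single_eq_same,
      Pi.single_eq_of_ne (Ne.symm hj), smul_zero, add_zero, Matrix.mulVec_smul, smul_smul,
      mul_inv_cancel₀ hc, one_smul, Matrix.toLin'_apply]
    · intro k _ hk
      rw [Pi.single_eq_of_ne hk, Matrix.mulVec_zero]
    · simp
  · rintro _ ⟨w, rfl⟩
    refine ⟨Pi.single i (c⁻¹ • w), ?_⟩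
    rw [convRow_apply, Finset.sum_eq_single i, Pi.single_eq_same, Matrix.mulVec_smul, smul_smul,
      mul_inv_cancel₀ hc, one_smul, smul_smul, mul_comm s]
    · simp
    · intro k _ hk
      rw [Pi.single_eq_of_ne hk, Matrix.mulVec_zero]
    · simp

/-- The maps φ_i induced by v ↦ B_i(row_i v) satisfy φ_i C_j = c B_i φ_j + δ_ij s φ_i. With c' c = 1
and c' s = -s', the map Φ(w) = ∑ φ_i(w_i) therefore turns the convolution matrices of C into the
B_i. -/
theorem IsMC.symm {c s c' s' : ℂ} {B C : Fin 3 → Matrix (Fin 3) (Fin 3) ℂ} (h : MCData c s B)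
    (hstar : Star fun i => Matrix.toLin' (B i)) (hstarstar : StarStar fun i => Matrix.toLin' (B i))
    (h' : MCData c' s' C) (hc : c' * c = 1) (hs : c' * s = -s') (hC : IsMC c s B C) :
    IsMC c' s' C B := by
  obtain ⟨π, hπ, hker, hC⟩ := hC
  obtain ⟨σ, hσ⟩ := π.exists_rightInverse_of_surjective (LinearMap.range_eq_top.2 hπ)
  let φ : Fin 3 → (Fin 3 → ℂ) →ₗ[ℂ] (Fin 3 → ℂ) := fun i =>
    (B i).mulVecLin ∘ₗ convRow c s B i ∘ₗ σ
  have hφ : ∀ i v, φ i (π v) = (B i).mulVec (convRow c s B i v) := fun i v => by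
    change (B i).mulVec (convRow c s B i (σ (π v))) = _
    rw [← sub_eq_zero, ← Matrix.mulVec_sub, ← map_sub]
    refine h.mulVec_convRow_eq_zero ?_ i
    rw [← hker, LinearMap.mem_ker, map_sub, sub_eq_zero]
    exact LinearMap.congr_fun hσ (π v)
  have hφC : ∀ i w, (C i).mulVec w = 0 → φ i w = 0 := fun i w hw => by
    obtain ⟨v, rfl⟩ := hπ w
    rw [← hC, ← LinearMap.mem_ker, hker] at hw
    obtain ⟨u, hu⟩ := hw
    have hu1 : ∀ j ≠ i, (B j).mulVec u = 0 := fun j hj => by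
      have := hu j
      rw [Pi.single_eq_of_ne hj, zero_sub, Matrix.mulVec_neg, neg_eq_zero] at this
      exact this
    have hu2 := hu i
    rw [Pi.single_eq_same, Matrix.mulVec_sub, sub_eq_zero] at hu2
    have hu0 : u = 0 := by
      -- Since B_j u = 0 for j ≠ i, the scalar sum gives B_i u = -(s/c) u, and c' = c⁻¹; this is
      -- where (∗) enters.
      refine mulVec_eq_zero_of_star hstar (i := i) (τ := c' * s) hu1 ?_
      have := h.sum_mulVec u
      rw [Finset.sum_eq_single i (fun j _ hj => hu1 j hj) (by simp)] at this
      rw [← one_smul ℂ ((B i).mulVec u), ← hc, ← smul_smul, this, smul_smul, ← add_smul]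
      simp
    rw [hφ, hu2, hu0, Matrix.mulVec_zero]
  have hφsum : ∀ w, ∑ i, φ i w = 0 := fun w => by
    obtain ⟨v, rfl⟩ := hπ w
    simp only [hφ, convRow_apply, Matrix.mulVec_add, Matrix.mulVec_smul, Finset.sum_add_distrib,
      ← Finset.smul_sum]
    rw [h.sum_mulVec, neg_smul, neg_add_cancel]
  let Φ : (Fin 3 → Fin 3 → ℂ) →ₗ[ℂ] (Fin 3 → ℂ) := ∑ i, φ i ∘ₗ LinearMap.proj i
  have hΦ : ∀ w, Φ w = ∑ i, φ i (w i) := fun w => by simp [Φ]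
  have hsurj : Function.Surjective Φ := fun y => by
    -- If every row takes the value -(c/s) y, then Φ gives -(c/s) ∑ B_i y = y.
    choose v hv using fun i => h.convRow_surjective hstarstar i ((-(s⁻¹ * c)) • y)
    refine ⟨fun i => π (v i), ?_⟩
    rw [hΦ]
    simp only [hφ, hv, Matrix.mulVec_smul, ← Finset.smul_sum]
    rw [neg_smul, ← smul_smul, h.sum_mulVec, neg_smul, smul_neg, neg_neg, smul_smul,
      inv_mul_cancel₀ h.s_ne_zero, one_smul]
  refine ⟨Φ, hsurj, ?_, fun i w => ?_⟩
  · symm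
    refine Submodule.eq_of_le_of_finrank_eq ?_ ?_
    · rintro w ⟨u, hu⟩
      rw [LinearMap.mem_ker, hΦ, ← hφsum u, ← sub_eq_zero, ← Finset.sum_sub_distrib]
      refine Finset.sum_eq_zero fun i _ => ?_
      rw [← map_sub]
      exact hφC i _ (hu i)
    · have h1 := LinearMap.finrank_range_add_finrank_ker Φ
      rw [LinearMap.range_eq_top.2 hsurj, finrank_top] at h1
      have h2 : Module.finrank ℂ (Fin 3 → Fin 3 → ℂ) = 9 := by
        rw [Module.finrank_pi_fintype]
        simp
      rw [h'.finrank_mcKernel]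
      simp only [Module.finrank_fintype_fun_eq_card, Fintype.card_fin] at h1
      omega
  · choose v hv using fun j => hπ (w j)
    have h1 : ∀ j, φ i ((C j).mulVec (w j)) = c • (B i).mulVec (φ j (w j)) +
        if j = i then s • φ i (w i) else 0 := fun j => by
      rw [← hv j, ← hC, hφ, hφ, convRow_apply, Finset.sum_eq_single j, Pi.single_eq_same,
        Matrix.mulVec_add, Matrix.mulVec_smul, Matrix.mulVec_smul]
      · congr 1
        split_ifs with hj
        · subst hj
          rw [Pi.single_eq_same, ← hv, hφ]
        · rw [Pi.single_eq_of_ne (Ne.symm hj), Matrix.mulVec_zero, smul_zero]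
      · intro k _ hk
        rw [Pi.single_eq_of_ne hk, Matrix.mulVec_zero]
      · simp
    rw [hΦ, Finset.sum_eq_single i, Pi.single_eq_same, convRow_apply, map_add, map_smul, map_smul,
      map_sum, hΦ, Matrix.mulVec_sum]
    · simp only [h1, Finset.sum_add_distrib, Finset.sum_ite_eq', Finset.mem_univ, if_true,
        ← Finset.smul_sum]
      rw [smul_add, smul_smul, hc, one_smul, smul_smul, hs, neg_smul, add_assoc, neg_add_cancel,
        add_zero]
    · intro k _ hk
      rw [Pi.single_eq_of_ne hk, map_zero]
    · simp

theorem IsS0.conj_symm {q : ℂ} (hq0 : 0 < ‖q‖) (hq1 : ‖q‖ < 1) {d b a : QSystem}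
    (hd : d.Admissible) {B : Fin 3 → Matrix (Fin 3) (Fin 3) ℂ} (hB : IsResidueTuple q d B)
    (hstar : Star fun i => Matrix.toLin' (B i)) (hstarstar : StarStar fun i => Matrix.toLin' (B i))
    (hb : IsS0 q d b) (ha : IsS0 q b a) : a.Conj d := by
  have h1q := one_sub_ne_zero_of_norm_lt_one hq1
  have hbA := hd.s0 hq0 hq1 hb
  have he3 := QSystem.e₃_s0 hb.1
  have hp : b.prod₃ = d.prod₃ := by rw [QSystem.prod₃, QSystem.prod₃, he3]
  have hE := hd.isE8.prod₃_ne_zero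
  have hκ0 := hd.isE8.κ_ne_zero
  have hκb := hb.2.1
  rw [isResidueTuple_iff hq1 hd.isE8.e₃_ne_zero] at hB
  obtain ⟨-, -, B₁, C, hB₁, hC, hMC⟩ := (isS0_iff hq0 hq1 hd).1 hb
  obtain ⟨-, -, C₁, F, hC₁, hF, hMC'⟩ := (isS0_iff hq0 hq1 hbA).1 ha
  obtain rfl : B₁ = B := fuchsVal_injective h1q hd.isE8.e₃_ne_zero hd.isE8.e₃_injective
    fun x => by rw [← hB₁, hB]
  obtain rfl : C₁ = C := fuchsVal_injective h1q hd.isE8.e₃_ne_zero hd.isE8.e₃_injective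
    fun x => by rw [← hC, ← he3, hC₁]
  have hsymm := hMC.symm (hd.mcData h1q hB) hstar hstarstar (hbA.mcData h1q hC₁)
    (by
      rw [QSystem.mcParam, QSystem.mcParam, hp, hκb]
      field_simp)
    (by
      rw [QSystem.mcNumber, QSystem.mcNumber, QSystem.mcParam, QSystem.mcParam, hp, hκb]
      field_simp
      ring)
  obtain ⟨G, hG⟩ := hMC'.unique hsymm
  refine ⟨funext fun i => ?_, ?_, G, fun x => ?_⟩
  · rw [ha.1, hb.1, hp, hκb]
    split_ifs
    · rfl
    · field_simp
  · rw [ha.2.1, hp, hκb]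
    field_simp
  · rw [hF, hB, ← fuchsVal_conj, he3, funext hG]

/-! ### Frames adapted to the middle convolution -/

/-- The `9 × 9` matrix with columns `s_b`, `k_b` in the block `b`, and the diagonal vectors. -/
def frame {R : Type*} [CommRing R] (s : Fin 3 → Fin 3 → Fin 3 → R) (k : Fin 3 → Fin 3 → R) :
    Matrix (Fin 3 × Fin 3) (Fin 3 × Fin 3) R :=
  Matrix.of fun p m => ![s m.2 p.1 p.2, if p.1 = m.2 then k p.1 p.2 else 0,
    if p.2 = m.2 then 1 else 0] m.1

theorem frame_map {R S : Type*} [CommRing R] [CommRing S] (f : R →+* S)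
    (s : Fin 3 → Fin 3 → Fin 3 → R) (k : Fin 3 → Fin 3 → R) :
    (frame s k).map f = frame (fun b r a => f (s b r a)) fun r a => f (k r a) := by
  ext ⟨r, a⟩ ⟨m, b⟩
  fin_cases m <;> simp [frame, apply_ite f]

/-- The matrix of a linear map on the standard basis, in the layout used by `frame`. -/
def sectionCoeff (σ : (Fin 3 → ℂ) →ₗ[ℂ] (Fin 3 → Fin 3 → ℂ)) (b r a : Fin 3) : ℂ :=
  σ (Pi.single b 1) r a

theorem frame_mulVec (σ : (Fin 3 → ℂ) →ₗ[ℂ] (Fin 3 → Fin 3 → ℂ)) (k : Fin 3 → Fin 3 → ℂ)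
    (t : Fin 3 × Fin 3 → ℂ) (r a : Fin 3) :
    (frame (sectionCoeff σ) k).mulVec t (r, a) =
      σ (fun b => t (0, b)) r a + t (1, r) * k r a + t (2, a) := by
  have h : σ (fun b => t (0, b)) r a = ∑ b, t (0, b) * σ (Pi.single b 1) r a := by
    conv_lhs => rw [pi_eq_sum_univ' (fun b => t (0, b))]
    simp only [map_sum, map_smul, Finset.sum_apply, Pi.smul_apply, smul_eq_mul]
  rw [h, Matrix.mulVec, dotProduct, Fintype.sum_prod_type, Fin.sum_univ_three (fun x => ∑ y, _)]
  simp [frame, sectionCoeff, mul_comm]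

/-- The coordinates along the first three columns of the frame. -/
def frameProj (σ : (Fin 3 → ℂ) →ₗ[ℂ] (Fin 3 → Fin 3 → ℂ)) (k : Fin 3 → Fin 3 → ℂ) :
    (Fin 3 → Fin 3 → ℂ) →ₗ[ℂ] (Fin 3 → ℂ) where
  toFun v a := (frame (sectionCoeff σ) k)⁻¹.mulVec (fun p => v p.1 p.2) (0, a)
  map_add' v w := by
    funext a
    exact congrFun (Matrix.mulVec_add (frame (sectionCoeff σ) k)⁻¹ (fun p => v p.1 p.2)
      fun p => w p.1 p.2) (0, a)
  map_smul' t v := by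
    funext a
    exact congrFun (Matrix.mulVec_smul (frame (sectionCoeff σ) k)⁻¹ t fun p => v p.1 p.2) (0, a)

theorem frameProj_apply (σ : (Fin 3 → ℂ) →ₗ[ℂ] (Fin 3 → Fin 3 → ℂ)) (k : Fin 3 → Fin 3 → ℂ)
    (v : Fin 3 → Fin 3 → ℂ) (a : Fin 3) : frameProj σ k v a =
      (frame (sectionCoeff σ) k)⁻¹.mulVec (fun p => v p.1 p.2) (0, a) := rfl

theorem frameProj_of_mulVec {σ : (Fin 3 → ℂ) →ₗ[ℂ] (Fin 3 → Fin 3 → ℂ)} {k : Fin 3 → Fin 3 → ℂ}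
    (hdet : (frame (sectionCoeff σ) k).det ≠ 0) {v : Fin 3 → Fin 3 → ℂ} {t : Fin 3 × Fin 3 → ℂ}
    (h : ∀ r a, v r a = σ (fun b => t (0, b)) r a + t (1, r) * k r a + t (2, a)) (a : Fin 3) :
    frameProj σ k v a = t (0, a) := by
  have h1 : (fun p : Fin 3 × Fin 3 => v p.1 p.2) = (frame (sectionCoeff σ) k).mulVec t := by
    funext p
    rw [h, ← frame_mulVec]
  rw [frameProj_apply, h1, Matrix.mulVec_mulVec, Matrix.nonsing_inv_mul _ (isUnit_iff_ne_zero.2 hdet),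
    Matrix.one_mulVec]

theorem frameProj_section {σ : (Fin 3 → ℂ) →ₗ[ℂ] (Fin 3 → Fin 3 → ℂ)} {k : Fin 3 → Fin 3 → ℂ}
    (hdet : (frame (sectionCoeff σ) k).det ≠ 0) (u : Fin 3 → ℂ) : frameProj σ k (σ u) = u := by
  funext a
  exact frameProj_of_mulVec hdet (t := fun p => if p.1 = 0 then u p.2 else 0) (by simp) a

theorem ne_zero_of_frame_det_ne_zero {σ : (Fin 3 → ℂ) →ₗ[ℂ] (Fin 3 → Fin 3 → ℂ)}
    {k : Fin 3 → Fin 3 → ℂ} (hdet : (frame (sectionCoeff σ) k).det ≠ 0) (i : Fin 3) : k i ≠ 0 := by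
  intro h
  refine hdet (Matrix.det_eq_zero_of_column_eq_zero (1, i) fun p => ?_)
  simp only [frame, Matrix.of_apply, Matrix.cons_val_one, Matrix.cons_val_zero]
  split_ifs with hp
  · rw [hp, h]
    rfl
  · rfl

/-- The last six columns of the frame span exactly 𝒦 + ℒ, so this subspace is cut out by the
vanishing of the first three coordinates. -/
theorem ker_frameProj {σ : (Fin 3 → ℂ) →ₗ[ℂ] (Fin 3 → Fin 3 → ℂ)} {k : Fin 3 → Fin 3 → ℂ}
    (hdet : (frame (sectionCoeff σ) k).det ≠ 0) {B : Fin 3 → Matrix (Fin 3) (Fin 3) ℂ}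
    (hk : ∀ i v, (B i).mulVec v = 0 ↔ ∃ t : ℂ, v = t • k i) :
    LinearMap.ker (frameProj σ k) = mcKernel B := by
  ext v
  rw [LinearMap.mem_ker, mem_mcKernel]
  constructor
  · intro h
    let t := (frame (sectionCoeff σ) k)⁻¹.mulVec fun p => v p.1 p.2
    have ht : (fun p : Fin 3 × Fin 3 => v p.1 p.2) = (frame (sectionCoeff σ) k).mulVec t := by
      rw [Matrix.mulVec_mulVec, Matrix.mul_nonsing_inv _ (isUnit_iff_ne_zero.2 hdet),
        Matrix.one_mulVec]
    have h0 : (fun b => t (0, b)) = 0 := h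
    refine ⟨fun a => t (2, a), fun i => (hk i _).2 ⟨t (1, i), funext fun a => ?_⟩⟩
    have := congrFun ht (i, a)
    rw [frame_mulVec, h0, map_zero] at this
    simp at this
    simp [this]
  · rintro ⟨u, hu⟩
    choose t ht using fun i => (hk i _).1 (hu i)
    funext a
    rw [frameProj_of_mulVec hdet (t := fun p => ![0, t p.2, u p.2] p.1) (fun r a => ?_)]
    · rfl
    · have := congrFun (ht r) a
      have h0 : (fun b : Fin 3 => (![0, t b, u b] : Fin 3 → ℂ) 0) = 0 := rfl
      simp only [h0, map_zero]
      simp at this ⊢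
      linear_combination this

/-- The image of a section is complementary to 𝒦 + ℒ, and the remaining six columns are independent
because the B_i have no common kernel. -/
theorem MCData.frame_det_ne_zero {c s : ℂ} {B : Fin 3 → Matrix (Fin 3) (Fin 3) ℂ}
    (h : MCData c s B) {π : (Fin 3 → Fin 3 → ℂ) →ₗ[ℂ] (Fin 3 → ℂ)}
    (hker : LinearMap.ker π = mcKernel B) {σ : (Fin 3 → ℂ) →ₗ[ℂ] (Fin 3 → Fin 3 → ℂ)}
    (hσ : ∀ a, π (σ a) = a) {k : Fin 3 → Fin 3 → ℂ} (hk0 : ∀ i, k i ≠ 0)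
    (hk : ∀ i, (B i).mulVec (k i) = 0) : (frame (sectionCoeff σ) k).det ≠ 0 := by
  intro hdet
  obtain ⟨t, ht0, ht⟩ := Matrix.exists_mulVec_eq_zero_iff.2 hdet
  have h1 : ∀ r a, σ (fun b => t (0, b)) r a + t (1, r) * k r a + t (2, a) = 0 := fun r a => by
    rw [← frame_mulVec, ht]
    rfl
  let n : Fin 3 → Fin 3 → ℂ := fun r a => t (1, r) * k r a + t (2, a)
  have hn : n ∈ mcKernel B := by
    refine ⟨fun a => t (2, a), fun i => ?_⟩
    have : n i - (fun a => t (2, a)) = t (1, i) • k i := by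
      funext a
      simp [n]
    rw [this, Matrix.mulVec_smul, hk, smul_zero]
  have h2 : σ (fun b => t (0, b)) + n = 0 := by
    funext r a
    have := h1 r a
    simp only [n, Pi.add_apply, Pi.zero_apply]
    linear_combination this
  have h3 : (fun b => t (0, b)) = 0 := by
    rw [← hker, LinearMap.mem_ker] at hn
    have := congrArg π h2
    rwa [map_add, hσ, hn, add_zero, map_zero] at this
  simp only [h3, map_zero, Pi.zero_apply, zero_add] at h1
  have h4 : (fun a => t (2, a)) = 0 := h.eq_zero_of_mulVec fun i => by
    have : (fun a => t (2, a)) = (-t (1, i)) • k i := by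
      funext a
      have := h1 i a
      simp only [Pi.smul_apply, smul_eq_mul]
      linear_combination this
    rw [this, Matrix.mulVec_smul, hk, smul_zero]
  refine ht0 (funext fun p => ?_)
  obtain ⟨m, b⟩ := p
  have h5 : t (1, b) = 0 := by
    obtain ⟨a, ha⟩ := Function.ne_iff.1 (hk0 b)
    have := h1 b a
    rw [show t (2, a) = 0 from congrFun h4 a, add_zero] at this
    exact (mul_eq_zero.1 this).resolve_right ha
  fin_cases m
  exacts [congrFun h3 b, h5, congrFun h4 b]

/-! ### Rational functions of a system -/

/-- `F` is a rational function of the coordinates, with a power of `Δ` as denominator. -/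
def IsRat (Δ : MvPolynomial Coord ℂ) (F : QSystem → ℂ) : Prop :=
  ∃ (p : MvPolynomial Coord ℂ) (n : ℕ), ∀ d : QSystem, d.IsE8 → MvPolynomial.eval d.coord Δ ≠ 0 →
    F d = MvPolynomial.eval d.coord p / MvPolynomial.eval d.coord Δ ^ n

namespace IsRat

variable {Δ : MvPolynomial Coord ℂ} {F F' : QSystem → ℂ}

theorem of_eval (p : MvPolynomial Coord ℂ)
    (h : ∀ d : QSystem, d.IsE8 → F d = MvPolynomial.eval d.coord p) : IsRat Δ F :=
  ⟨p, 0, fun d hd _ => by rw [h d hd, pow_zero, div_one]⟩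

theorem const (a : ℂ) : IsRat Δ fun _ => a := of_eval (MvPolynomial.C a) fun _ _ => by simp

theorem e (i : Fin 9) : IsRat Δ fun d => d.e i :=
  of_eval (MvPolynomial.X (.inr (.inl i))) fun _ _ => by simp [QSystem.coord]

theorem κ : IsRat Δ fun d => d.κ :=
  of_eval (MvPolynomial.X (.inr (.inr ()))) fun _ _ => by simp [QSystem.coord]

theorem add (h : IsRat Δ F) (h' : IsRat Δ F') : IsRat Δ fun d => F d + F' d := by
  obtain ⟨p, n, hp⟩ := h
  obtain ⟨p', n', hp'⟩ := h'
  refine ⟨p * Δ ^ n' + p' * Δ ^ n, n + n', fun d hd hΔ => ?_⟩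
  beta_reduce
  rw [hp d hd hΔ, hp' d hd hΔ, map_add, map_mul, map_mul, map_pow, map_pow, pow_add]
  field_simp

theorem mul (h : IsRat Δ F) (h' : IsRat Δ F') : IsRat Δ fun d => F d * F' d := by
  obtain ⟨p, n, hp⟩ := h
  obtain ⟨p', n', hp'⟩ := h'
  refine ⟨p * p', n + n', fun d hd hΔ => ?_⟩
  beta_reduce
  rw [hp d hd hΔ, hp' d hd hΔ, map_mul, pow_add]
  field_simp

theorem sub (h : IsRat Δ F) (h' : IsRat Δ F') : IsRat Δ fun d => F d - F' d := by
  simpa [sub_eq_add_neg] using h.add ((const (-1)).mul h')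

theorem sum {ι : Type*} (t : Finset ι) {F : ι → QSystem → ℂ} (h : ∀ i, IsRat Δ (F i)) :
    IsRat Δ fun d => ∑ i ∈ t, F i d := by
  classical
  induction t using Finset.induction_on with
  | empty => simpa using const 0
  | insert i t hi ih => simpa [Finset.sum_insert hi] using (h i).add ih

theorem prod {ι : Type*} (t : Finset ι) {F : ι → QSystem → ℂ} (h : ∀ i ∈ t, IsRat Δ (F i)) :
    IsRat Δ fun d => ∏ i ∈ t, F i d := by
  classical
  induction t using Finset.induction_on with
  | empty => simpa using const 1
  | insert i t hi ih =>
    simpa [Finset.prod_insert hi] using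
      (h i (Finset.mem_insert_self i t)).mul (ih fun j hj => h j (Finset.mem_insert_of_mem hj))

theorem inv_of_dvd {p : MvPolynomial Coord ℂ} (hp : p ∣ Δ)
    (h : ∀ d : QSystem, d.IsE8 → F d = MvPolynomial.eval d.coord p) :
    IsRat Δ fun d => (F d)⁻¹ := by
  obtain ⟨r, rfl⟩ := hp
  refine ⟨r, 1, fun d hd hΔ => ?_⟩
  rw [map_mul] at hΔ
  have h1 := left_ne_zero_of_mul hΔ
  have h2 := right_ne_zero_of_mul hΔ
  beta_reduce
  rw [h d hd, map_mul, pow_one]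
  field_simp

theorem congr (h : IsRat Δ F) (hF : ∀ d : QSystem, d.IsE8 → F' d = F d) : IsRat Δ F' := by
  obtain ⟨p, n, hp⟩ := h
  exact ⟨p, n, fun d hd hΔ => by rw [hF d hd, hp d hd hΔ]⟩

end IsRat

/-! ### Matrices of polynomials in the coordinates -/

theorem QSystem.IsE8.at'_eq_coord {d : QSystem} (hd : d.IsE8) (x : ℂ) (i j : Fin 3) :
    d.at' x i j = (1 : Matrix (Fin 3) (Fin 3) ℂ) i j + x * d.coord (.inl (0, i, j)) +
      x ^ 2 * d.coord (.inl (1, i, j)) + d.κ * x ^ 3 * (1 : Matrix (Fin 3) (Fin 3) ℂ) i j := by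
  obtain ⟨A₁, A₂, h⟩ := hd.form
  have hA : d.A i j = C ((1 : Matrix (Fin 3) (Fin 3) ℂ) i j) + C (A₁ i j) * X +
      C (A₂ i j) * X ^ 2 + C (d.κ * (1 : Matrix (Fin 3) (Fin 3) ℂ) i j) * X ^ 3 := by
    refine Polynomial.funext fun y => ?_
    have := congrFun (congrFun (h y) i) j
    change (d.A i j).eval y = _ at this
    rw [this]
    simp only [Matrix.add_apply, Matrix.smul_apply, smul_eq_mul, eval_add, eval_mul, eval_C,
      eval_X, eval_pow]
    ring
  have h1 : d.coord (.inl (0, i, j)) = A₁ i j := by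
    change (d.A i j).coeff 1 = _
    rw [hA]
    simp only [coeff_add, coeff_C_mul, coeff_C, coeff_X, coeff_X_pow]
    simp
  have h2 : d.coord (.inl (1, i, j)) = A₂ i j := by
    change (d.A i j).coeff 2 = _
    rw [hA]
    simp only [coeff_add, coeff_C_mul, coeff_C, coeff_X, coeff_X_pow]
    simp
  rw [h, h1, h2]
  simp only [Matrix.add_apply, Matrix.smul_apply, smul_eq_mul]

/-- The parameter `e_i`, `i ≤ 3`, as a polynomial in the coordinates. -/
def ePoly (i : Fin 3) : MvPolynomial Coord ℂ :=
  MvPolynomial.X (.inr (.inl (Fin.castLE (by norm_num) i)))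

theorem eval_ePoly (d : QSystem) (i : Fin 3) : MvPolynomial.eval d.coord (ePoly i) = d.e₃ i := by
  simp [ePoly, QSystem.coord, QSystem.e₃]

/-- The matrix `A(-e_i)`, with entries polynomials in the coordinates. -/
def atNegPoly (i : Fin 3) : Matrix (Fin 3) (Fin 3) (MvPolynomial Coord ℂ) :=
  Matrix.of fun a b => MvPolynomial.C ((1 : Matrix (Fin 3) (Fin 3) ℂ) a b) -
    ePoly i * MvPolynomial.X (.inl (0, a, b)) + ePoly i ^ 2 * MvPolynomial.X (.inl (1, a, b)) -
      MvPolynomial.X (.inr (.inr ())) * ePoly i ^ 3 *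
        MvPolynomial.C ((1 : Matrix (Fin 3) (Fin 3) ℂ) a b)

theorem atNegPoly_map_eval {d : QSystem} (hd : d.IsE8) (i : Fin 3) :
    (atNegPoly i).map (MvPolynomial.eval d.coord) = d.at' (-d.e₃ i) := by
  ext a b
  rw [hd.at'_eq_coord]
  have hκ : d.coord (.inr (.inr ())) = d.κ := rfl
  simp only [atNegPoly, Matrix.map_apply, Matrix.of_apply, map_add, map_sub, map_mul, map_pow,
    MvPolynomial.eval_C, MvPolynomial.eval_X, eval_ePoly, hκ]
  ring

/-- The vectors spanning the kernels of `A(-e_i)`: the `j i`-th column of the adjugate. -/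
def kerPoly (j : Fin 3 → Fin 3) (i a : Fin 3) : MvPolynomial Coord ℂ :=
  (atNegPoly i).adjugate a (j i)

theorem eval_kerPoly {d : QSystem} (hd : d.IsE8) (j : Fin 3 → Fin 3) (i a : Fin 3) :
    MvPolynomial.eval d.coord (kerPoly j i a) = (d.at' (-d.e₃ i)).adjugate a (j i) := by
  rw [← atNegPoly_map_eval hd]
  exact congrFun (congrFun ((MvPolynomial.eval d.coord).map_adjugate (atNegPoly i)) a) (j i)

/-- The frame attached to a section `σ` and a choice of columns `j`. -/
def framePoly (σ : (Fin 3 → ℂ) →ₗ[ℂ] (Fin 3 → Fin 3 → ℂ)) (j : Fin 3 → Fin 3) :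
    Matrix (Fin 3 × Fin 3) (Fin 3 × Fin 3) (MvPolynomial Coord ℂ) :=
  frame (fun b r a => MvPolynomial.C (sectionCoeff σ b r a)) (kerPoly j)

/-- The vectors spanning the kernels of `A(-e_i)`. -/
def QSystem.kerVec (d : QSystem) (j : Fin 3 → Fin 3) (i a : Fin 3) : ℂ :=
  (d.at' (-d.e₃ i)).adjugate a (j i)

theorem framePoly_map_eval {d : QSystem} (hd : d.IsE8)
    (σ : (Fin 3 → ℂ) →ₗ[ℂ] (Fin 3 → Fin 3 → ℂ)) (j : Fin 3 → Fin 3) :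
    (framePoly σ j).map (MvPolynomial.eval d.coord) = frame (sectionCoeff σ) (d.kerVec j) := by
  rw [framePoly, frame_map]
  congr 1
  · simp
  · funext i a
    exact eval_kerPoly hd j i a

/-- The common denominator of the rational functions that compute `s_0`. -/
def denom (σ : (Fin 3 → ℂ) →ₗ[ℂ] (Fin 3 → Fin 3 → ℂ)) (j : Fin 3 → Fin 3) :
    MvPolynomial Coord ℂ :=
  (framePoly σ j).det * MvPolynomial.X (.inr (.inr ())) * (∏ i, ePoly i) *
    ∏ i, ∏ k ∈ Finset.univ.erase i, (ePoly k - ePoly i)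

theorem eval_framePoly_det {d : QSystem} (hd : d.IsE8)
    (σ : (Fin 3 → ℂ) →ₗ[ℂ] (Fin 3 → Fin 3 → ℂ)) (j : Fin 3 → Fin 3) :
    MvPolynomial.eval d.coord (framePoly σ j).det = (frame (sectionCoeff σ) (d.kerVec j)).det := by
  rw [RingHom.map_det, ← framePoly_map_eval hd]
  rfl

/-- The other factors of the denominator never vanish on systems of the given form, so regularity
means only that the frame is invertible. -/
theorem eval_denom_ne_zero {d : QSystem} (hd : d.IsE8)
    (σ : (Fin 3 → ℂ) →ₗ[ℂ] (Fin 3 → Fin 3 → ℂ)) (j : Fin 3 → Fin 3) :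
    MvPolynomial.eval d.coord (denom σ j) ≠ 0 ↔
      (frame (sectionCoeff σ) (d.kerVec j)).det ≠ 0 := by
  have h1 : d.coord (.inr (.inr ())) ≠ 0 := hd.κ_ne_zero
  have h2 : ∏ i, d.e₃ i ≠ 0 := hd.prod₃_ne_zero
  have h3 : ∏ i, ∏ k ∈ Finset.univ.erase i, (d.e₃ k - d.e₃ i) ≠ 0 :=
    Finset.prod_ne_zero_iff.2 fun i _ => Finset.prod_ne_zero_iff.2 fun k hk =>
      sub_ne_zero.2 (hd.e₃_injective.ne (Finset.ne_of_mem_erase hk))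
  simp only [denom, map_mul, map_prod, map_sub, MvPolynomial.eval_X, eval_ePoly,
    eval_framePoly_det hd, ne_eq, mul_eq_zero, h1, h2, h3, or_false]

/-- The residue `A_i` as a function of the system. -/
def QSystem.residue (q : ℂ) (d : QSystem) (i : Fin 3) : Matrix (Fin 3) (Fin 3) ℂ :=
  (resFactor q d.e₃ i)⁻¹ • d.at' (-d.e₃ i)

/-- A representative of the middle convolution of the residues, where the basis of the quotient
space is taken from a frame. -/
def QSystem.mcMatrix (q : ℂ) (σ : (Fin 3 → ℂ) →ₗ[ℂ] (Fin 3 → Fin 3 → ℂ)) (j : Fin 3 → Fin 3)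
    (d : QSystem) (i : Fin 3) : Matrix (Fin 3) (Fin 3) ℂ :=
  Matrix.of fun a b => ∑ r, (frame (sectionCoeff σ) (d.kerVec j))⁻¹ (0, a) (i, r) *
    (d.mcParam * ∑ k, ∑ l, d.residue q k r l * sectionCoeff σ b k l +
      d.mcNumber q * sectionCoeff σ b i r)

/-- The representative of `s_0 . d` obtained from a frame. -/
def QSystem.s0Rep (q : ℂ) (σ : (Fin 3 → ℂ) →ₗ[ℂ] (Fin 3 → Fin 3 → ℂ)) (j : Fin 3 → Fin 3)
    (d : QSystem) : QSystem where
  e i := if (i : ℕ) < 3 then d.e i else d.κ * d.prod₃ * d.e i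
  κ := (d.κ * d.prod₃ ^ 2)⁻¹
  A := fuchsPoly q d.e₃ (d.mcMatrix q σ j)

theorem QSystem.Admissible.mulVec_residue_eq_zero_iff {q : ℂ} (hq : 1 - q ≠ 0) {d : QSystem}
    (hd : d.Admissible) {j : Fin 3 → Fin 3} {i : Fin 3} (hj : d.kerVec j i ≠ 0) (v : Fin 3 → ℂ) :
    (d.residue q i).mulVec v = 0 ↔ ∃ t : ℂ, v = t • d.kerVec j i := by
  rw [residue, Matrix.smul_mulVec, smul_eq_zero_iff_right (inv_ne_zero
    (resFactor_ne_zero hq hd.isE8.e₃_ne_zero hd.isE8.e₃_injective i))]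
  have hdet : (d.at' (-d.e₃ i)).det = 0 := hd.isE8.det_neg_e (Fin.castLE (by norm_num) i)
  exact mulVec_eq_zero_iff_of_adjugate hdet hj v

theorem QSystem.Admissible.isS0_s0Rep {q : ℂ} (hq0 : 0 < ‖q‖) (hq1 : ‖q‖ < 1) {d : QSystem}
    (hd : d.Admissible) {σ : (Fin 3 → ℂ) →ₗ[ℂ] (Fin 3 → Fin 3 → ℂ)} {j : Fin 3 → Fin 3}
    (hdet : (frame (sectionCoeff σ) (d.kerVec j)).det ≠ 0) : IsS0 q d (d.s0Rep q σ j) := by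
  have h1q := one_sub_ne_zero_of_norm_lt_one hq1
  have hB := hd.isE8.exists_fuchsVal h1q
  refine (isS0_iff hq0 hq1 hd).2 ⟨fun i => rfl, rfl, d.residue q, d.mcMatrix q σ j, hB, fun x =>
    fuchsPoly_map_eval _ _ _ _, ?_⟩
  have hker := ker_frameProj hdet (B := d.residue q) fun i v =>
    hd.mulVec_residue_eq_zero_iff h1q (ne_zero_of_frame_det_ne_zero hdet i) v
  convert! (hd.mcData h1q hB).isMC_of_section hker (frameProj_section hdet) using 1
  funext i
  ext a b
  rw [LinearMap.toMatrix'_apply]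
  simp only [LinearMap.comp_apply, LinearMap.coe_single]
  rw [frameProj_apply, Matrix.mulVec, dotProduct, Fintype.sum_prod_type, Finset.sum_eq_single i]
  · simp only [Pi.single_eq_same, mcMatrix, Matrix.of_apply]
    refine Finset.sum_congr rfl fun r _ => ?_
    rw [convRow_apply]
    simp only [Pi.add_apply, Pi.smul_apply, smul_eq_mul, Finset.sum_apply, Matrix.mulVec,
      dotProduct]
    rfl
  · intro k _ hk
    simp [Pi.single_eq_of_ne hk]
  · simp

/-! ### Rationality of the representative -/

section

variable (q : ℂ) (σ : (Fin 3 → ℂ) →ₗ[ℂ] (Fin 3 → Fin 3 → ℂ)) (j : Fin 3 → Fin 3)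

theorem isRat_e₃ (Δ : MvPolynomial Coord ℂ) (i : Fin 3) : IsRat Δ fun d => d.e₃ i := IsRat.e _

theorem isRat_prod₃ (Δ : MvPolynomial Coord ℂ) : IsRat Δ fun d => d.prod₃ :=
  IsRat.prod _ fun i _ => isRat_e₃ Δ i

theorem isRat_inv_e₃ (i : Fin 3) : IsRat (denom σ j) fun d => (d.e₃ i)⁻¹ :=
  IsRat.inv_of_dvd (p := ePoly i)
    (((Finset.dvd_prod_of_mem ePoly (Finset.mem_univ i)).mul_left _).mul_right _)
    fun d _ => (eval_ePoly d i).symm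

theorem isRat_inv_prod₃ : IsRat (denom σ j) fun d => (d.prod₃)⁻¹ :=
  (IsRat.prod Finset.univ fun i _ => isRat_inv_e₃ σ j i).congr fun d _ => by
    rw [QSystem.prod₃, Finset.prod_inv_distrib]

theorem isRat_inv_κ : IsRat (denom σ j) fun d => (d.κ)⁻¹ :=
  IsRat.inv_of_dvd (p := MvPolynomial.X (.inr (.inr ())))
    (((dvd_mul_left _ _).mul_right _).mul_right _) fun d _ => by simp [QSystem.coord]

theorem isRat_inv_resFactor (i : Fin 3) :
    IsRat (denom σ j) fun d => (resFactor q d.e₃ i)⁻¹ := by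
  have h : ∀ k ∈ Finset.univ.erase i,
      IsRat (denom σ j) fun d => d.e₃ k * (d.e₃ k - d.e₃ i)⁻¹ := fun k hk =>
    (isRat_e₃ _ k).mul (IsRat.inv_of_dvd (p := ePoly k - ePoly i)
      (((Finset.dvd_prod_of_mem (fun k => ePoly k - ePoly i) hk).trans
        (Finset.dvd_prod_of_mem (fun i => ∏ k ∈ Finset.univ.erase i, (ePoly k - ePoly i))
          (Finset.mem_univ i))).mul_left _)
      fun d _ => by rw [map_sub, eval_ePoly, eval_ePoly])
  refine ((IsRat.const (1 - q)⁻¹).mul (IsRat.prod _ h)).congr fun d hd => ?_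
  rw [resFactor, mul_inv, ← Finset.prod_inv_distrib]
  congr 1
  refine Finset.prod_congr rfl fun k _ => ?_
  have := hd.e₃_ne_zero k
  rw [one_sub_div this, inv_div, div_eq_mul_inv]

theorem isRat_residue (i a b : Fin 3) : IsRat (denom σ j) fun d => d.residue q i a b :=
  (isRat_inv_resFactor q σ j i).mul (IsRat.of_eval (atNegPoly i a b) fun d hd => by
    rw [← atNegPoly_map_eval hd]
    rfl)

theorem isRat_mcParam : IsRat (denom σ j) fun d => d.mcParam :=
  ((isRat_inv_κ σ j).mul (isRat_inv_prod₃ σ j)).congr fun d _ => by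
    rw [QSystem.mcParam, mul_inv]

theorem isRat_mcNumber : IsRat (denom σ j) fun d => d.mcNumber q :=
  (((IsRat.const 1).sub (isRat_mcParam σ j)).mul (IsRat.const (1 - q)⁻¹)).congr fun d _ => by
    rw [QSystem.mcNumber, div_eq_mul_inv]

theorem isRat_frame_inv (m m' : Fin 3 × Fin 3) :
    IsRat (denom σ j) fun d => (frame (sectionCoeff σ) (d.kerVec j))⁻¹ m m' := by
  have h1 : IsRat (denom σ j) fun d => (frame (sectionCoeff σ) (d.kerVec j)).det⁻¹ :=
    IsRat.inv_of_dvd (p := (framePoly σ j).det)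
      (((dvd_mul_right _ _).mul_right _).mul_right _)
      fun d hd => (eval_framePoly_det hd σ j).symm
  have h2 : IsRat (denom σ j) fun d => (frame (sectionCoeff σ) (d.kerVec j)).adjugate m m' :=
    IsRat.of_eval ((framePoly σ j).adjugate m m') fun d hd => by
      rw [← framePoly_map_eval hd]
      exact (congrFun (congrFun ((MvPolynomial.eval d.coord).map_adjugate (framePoly σ j)) m)
        m').symm
  refine (h1.mul h2).congr fun d _ => ?_
  rw [Matrix.inv_def, Ring.inverse_eq_inv', Matrix.smul_apply, smul_eq_mul]

theorem isRat_mcMatrix (i a b : Fin 3) : IsRat (denom σ j) fun d => d.mcMatrix q σ j i a b :=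
  IsRat.congr (IsRat.sum Finset.univ fun r => (isRat_frame_inv σ j (0, a) (i, r)).mul
    (((isRat_mcParam σ j).mul (IsRat.sum Finset.univ fun k => IsRat.sum Finset.univ fun l =>
      (isRat_residue q σ j k r l).mul (IsRat.const (sectionCoeff σ b k l)))).add
      ((isRat_mcNumber q σ j).mul (IsRat.const (sectionCoeff σ b i r))))) fun _ _ => rfl

theorem isRat_s0Rep_coord (v : Coord) : IsRat (denom σ j) fun d => (d.s0Rep q σ j).coord v := by
  rcases v with ⟨k, a, b⟩ | i | _
  · fin_cases k
    · refine (((IsRat.sum Finset.univ fun i => isRat_inv_e₃ σ j i).mul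
        (IsRat.const ((1 : Matrix (Fin 3) (Fin 3) ℂ) a b))).sub ((IsRat.const (1 - q)).mul
          (IsRat.sum Finset.univ fun i => (isRat_inv_e₃ σ j i).mul
            (isRat_mcMatrix q σ j i a b)))).congr fun d _ => ?_
      change (fuchsPoly q d.e₃ (d.mcMatrix q σ j) a b).coeff 1 = _
      simp only [fuchsPoly, Matrix.of_apply, coeff_add, coeff_C_mul, coeff_C, coeff_X, coeff_X_pow]
      simp [fuchsCoeff₁, Matrix.sum_apply]
    · have hT : IsRat (denom σ j) fun d => ∑ i, d.e₃ i := IsRat.sum _ fun i => isRat_e₃ _ i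
      refine ((isRat_inv_prod₃ σ j).mul ((hT.mul
        (IsRat.const ((1 : Matrix (Fin 3) (Fin 3) ℂ) a b))).sub ((IsRat.const (1 - q)).mul
          (IsRat.sum Finset.univ fun i => (hT.sub (isRat_e₃ _ i)).mul
            (isRat_mcMatrix q σ j i a b))))).congr fun d _ => ?_
      change (fuchsPoly q d.e₃ (d.mcMatrix q σ j) a b).coeff 2 = _
      simp only [fuchsPoly, Matrix.of_apply, coeff_add, coeff_C_mul, coeff_C, coeff_X, coeff_X_pow]
      simp [fuchsCoeff₂, Matrix.sum_apply, QSystem.prod₃]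
  · change IsRat _ fun d => if (i : ℕ) < 3 then d.e i else d.κ * d.prod₃ * d.e i
    split_ifs
    · exact IsRat.e i
    · exact (IsRat.κ.mul (isRat_prod₃ _)).mul (IsRat.e i)
  · refine ((isRat_inv_κ σ j).mul ((isRat_inv_prod₃ σ j).mul (isRat_inv_prod₃ σ j))).congr
      fun d _ => ?_
    change (d.κ * d.prod₃ ^ 2)⁻¹ = _
    rw [mul_inv, sq, mul_inv]

end

theorem QSystem.Admissible.s0RationalAt {q : ℂ} (hq0 : 0 < ‖q‖) (hq1 : ‖q‖ < 1) {d : QSystem}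
    (hd : d.Admissible) : S0RationalAt q d := by
  have h1q := one_sub_ne_zero_of_norm_lt_one hq1
  have hB := hd.isE8.exists_fuchsVal h1q
  have hdat := hd.mcData h1q hB
  obtain ⟨π, hπ, hker⟩ := hdat.exists_surjective
  obtain ⟨σ, hσ⟩ := π.exists_rightInverse_of_surjective (LinearMap.range_eq_top.2 hπ)
  -- The section σ and the columns j are chosen at d and then kept fixed for all d', which makes the
  -- formulas rational in the coordinates.
  choose j hj using fun i : Fin 3 =>
    exists_col_ne_zero (hd.isE8.adjugate_ne_zero (Fin.castLE (by norm_num) i))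
  have hj0 : ∀ i, d.kerVec j i ≠ 0 := hj
  have hdet : (frame (sectionCoeff σ) (d.kerVec j)).det ≠ 0 :=
    hdat.frame_det_ne_zero hker (fun a => LinearMap.congr_fun hσ a) hj0 fun i =>
      (hd.mulVec_residue_eq_zero_iff h1q (hj0 i) _).2 ⟨1, (one_smul _ _).symm⟩
  choose p n hp using isRat_s0Rep_coord q σ j
  let N := Finset.univ.sup n
  have hn : ∀ v, n v ≤ N := fun v => Finset.le_sup (Finset.mem_univ v)
  -- All coordinates are brought over one power of the denominator. The exponent N + 1 is positive,
  -- so nonvanishing of the power implies nonvanishing of the denominator itself even when N = 0.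
  refine ⟨fun v => p v * denom σ j ^ (N + 1 - n v), denom σ j ^ (N + 1), ?_, fun d' hd' hres hΔ => ?_⟩
  · rw [map_pow]
    exact pow_ne_zero _ ((eval_denom_ne_zero hd.isE8 σ j).2 hdet)
  · rw [map_pow] at hΔ
    have hΔ' : MvPolynomial.eval d'.coord (denom σ j) ≠ 0 := fun h => hΔ (by
      rw [h, zero_pow (Nat.succ_ne_zero N)])
    have hA := hd'.admissible hres
    have hS := hA.isS0_s0Rep hq0 hq1 ((eval_denom_ne_zero hd' σ j).1 hΔ')
    refine ⟨_, hA.isE8_s0 hq0 hq1 hS, hS, fun v => ?_⟩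
    refine (hp v d' hd' hΔ').trans ?_
    rw [map_mul, map_pow, map_pow, div_eq_div_iff (pow_ne_zero _ hΔ') hΔ,
      mul_assoc, ← pow_add, Nat.sub_add_cancel ((hn v).trans (Nat.le_succ N))]

end QE8

end

theorem proposition4p4 (q : ℂ) (hq0 : 0 < ‖q‖) (hq1 : ‖q‖ < 1)
    (d : QE8.QSystem) (hd : d.IsE8) (hres : d.NonResonant)
    (B : Fin 3 → Matrix (Fin 3) (Fin 3) ℂ) (hB : QE8.IsResidueTuple q d B)
    (hstar : QE8.Star fun i => Matrix.toLin' (B i))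
    (hstarstar : QE8.StarStar fun i => Matrix.toLin' (B i)) :
    -- `s_0 . A` exists as a system of the same kind, and depends only on the class of `A`
    ((∃ b, QE8.IsS0 q d b) ∧ (∀ b, QE8.IsS0 q d b → b.IsE8) ∧
      ∀ d' b b', d.Conj d' → QE8.IsS0 q d b → QE8.IsS0 q d' b' → b.Conj b') ∧
    -- `s_0 . s_i . A ≃ s_i . s_0 . A` for `i = 1, …, 8`, `i ≠ 3` (here `i` is shifted by one)
    (∀ i : Fin 8, i ≠ 2 →
      (∃ a, QE8.IsS0 q (d.swap i) a) ∧
      ∀ a b, QE8.IsS0 q (d.swap i) a → QE8.IsS0 q d b → a.Conj (b.swap i)) ∧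
    -- `s_0 . s_0 . A ≃ A`
    (∀ b, QE8.IsS0 q d b → (∃ c, QE8.IsS0 q b c) ∧ ∀ c, QE8.IsS0 q b c → c.Conj d) ∧
    -- `s_0` is rational at `A`, and its inverse up to conjugation is rational at `s_0 . A`
    (QE8.S0RationalAt q d ∧ ∀ b, QE8.IsS0 q d b → QE8.S0RationalAt q b) := by
  have hA := hd.admissible hres
  refine ⟨⟨QE8.exists_isS0 hq0 hq1 hA, fun b hb => hA.isE8_s0 hq0 hq1 hb,
    fun d' b b' h hb hb' => ?_⟩, fun i hi => ⟨?_, fun a b ha hb => ?_⟩, fun b hb => ⟨?_,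
    fun c hc => ?_⟩, hA.s0RationalAt hq0 hq1, fun b hb => (hA.s0 hq0 hq1 hb).s0RationalAt hq0 hq1⟩
  · obtain ⟨he, hκ, G, hG⟩ := id h
    have he₃ : d'.e₃ = d.e₃ := by
      funext i
      simp only [QE8.QSystem.e₃, he]
    have hp : d'.prod₃ = d.prod₃ := by rw [QE8.QSystem.prod₃, he₃, QE8.QSystem.prod₃]
    refine ⟨funext fun i => ?_, ?_,
      hb.exists_conj hq0 hq1 hA (hA.conj h) hκ.symm 1 he₃ G hG hb'⟩
    · rw [hb.1, hb'.1, hp, he, hκ]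
    · rw [hb.2.1, hb'.2.1, hp, hκ]
  · exact QE8.exists_isS0 hq0 hq1 ((hd.swap i).admissible (hres.swap i))
  · exact ha.conj_swap hq0 hq1 hd hres hi hb
  · exact QE8.exists_isS0 hq0 hq1 (hA.s0 hq0 hq1 hb)
  · exact hb.conj_symm hq0 hq1 hA hB hstar hstarstar hc
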